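/- Let $\theta>0$, $\mu\in\mathbb R$, $0<\Omega<1$, and put $C=\frac{(1-\Omega)^2}{4\Omega}$, $\tilde\Omega=\frac{2\Omega}{\theta}$. Let $\gamma^0,\gamma^1$ be skew-Hermitian complex $2\times2$ matrices with $\gamma^\mu\gamma^\nu+\gamma^\nu\gamma^\mu=-2\delta^{\mu\nu}$. For $0<\alpha<1$ and $m,n,k,l\in\mathbb N$ with $n=m+h$, $k=l+h$ ($h\in\mathbb Z$) let $$\Gamma^\alpha_{m,n;k,l}=\Big(\frac{\sqrt{1-\alpha}}{1+C\alpha}\Big)^{m+l+h}(1-\alpha)^{-h/2}\sum_{u=\max(0,-h)}^{\min(m,l)}\frac{\sqrt{m!\,(m+h)!\,l!\,(l+h)!}}{(m-u)!\,(l-u)!\,(h+u)!\,u!}\Big(\frac{C\alpha(1+\Omega)}{\sqrt{1-\alpha}\,(1-\Omega)}\Big)^{m+l-2u},$$ and $\Gamma^\alpha_{m,n;k,l}=0$ if $n-m\ne k-l$. Let $$[x^0,\Gamma]_{m,n;k,l}=2\pi\theta\sqrt{\tfrac\theta8}\,\big\{\sqrt{m+1}\,\Gamma_{m+1,n;k,l}-\sqrt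 l\,\Gamma_{m,n;k,l-1}+\sqrt m\,\Gamma_{m-1,n;k,l}-\sqrt{l+1}\,\Gamma_{m,n;k,l+1}+\sqrt{n+1}\,\Gamma_{m,n+1;k,l}-\sqrt k\,\Gamma_{m,n;k-1,l}+\sqrt n\,\Gamma_{m,n-1;k,l}-\sqrt{k+1}\,\Gamma_{m,n;k+1,l}\big\},$$ $$[x^1,\Gamma]_{m,n;k,l}=2i\pi\theta\sqrt{\tfrac\theta8}\,\big\{\sqrt{m+1}\,\Gamma_{m+1,n;k,l}-\sqrt l\,\Gamma_{m,n;k,l-1}-\sqrt m\,\Gamma_{m-1,n;k,l}+\sqrt{l+1}\,\Gamma_{m,n;k,l+1}-\sqrt{n+1}\,\Gamma_{m,n+1;k,l}+\sqrt k\,\Gamma_{m,n;k-1,l}+\sqrt n\,\Gamma_{m,n-1;k,l}-\sqrt{k+1}\,\Gamma_{m,n;k+1,l}\big\},$$ where a term with a negative index is absent, and put $[\not x,\Gamma]=\gamma^0[x^0,\Gamma]+\gamma^1[x^1,\Gamma]$, $[\tilde{\not x},\Gamma]=\frac2\theta\big(-\gamma^0[x^1,\Gamma]+\gamma^1[x^0,\Gamma]\big)$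 and $$G^{\alpha,\rm comm}=\Big(i\tilde\Omega\frac{2-\alpha}{\alpha}[\not x,\Gamma^\alpha]+\Omega[\tilde{\not x},\Gamma^\alpha]\Big)S_\alpha,\qquad G^{\alpha,\rm mass}=-\mu\,\Gamma^\alpha S_\alpha,\qquad S_\alpha=\frac{2-\alpha}{2\sqrt{1-\alpha}}\mathbf 1_2-\frac{i\alpha}{2\sqrt{1-\alpha}}\gamma^0\gamma^1 .$$ For $M>1$ and $i\in\mathbb N$ the commutator part ($\bullet={\rm comm}$) and the mass part ($\bullet={\rm mass}$) of the vulcanized Gross–Neveu propagator in the $i$-th slice are $$G^{i,\bullet}_{m,n;k,l}=-\frac{2\Omega}{\theta^2\pi^2}\int_{M^{-i}}^{M^{-i+1}}w(\alpha)\,G^{\alpha,\bullet}_{m,n;k,l}\,d\alpha,\qquad w(\alpha)=\frac{(1-\alpha)^{\frac{\mu^2\theta}{8\Omega}-\frac12}}{1+C\alpha}.$$ Theorem. There is $\Omega_0\in(0,1)$ such that for every $\Omega\in(\Omega_0,1)$ and every slicing ratio $M>1$ there are $K,c>0$ and $i_0\in\mathbb N$, depending only on $\Omega$ and $M$, such that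 for all $\theta>0$, $\mu\in\mathbb R$, all $\gamma^0,\gamma^1$ as above, all $i\ge i_0$ and all $m,n,k,l\in\mathbb N$ with $h=n-m\ge0$ and $p=l-m\ge0$, every matrix entry of $G^{i,\rm comm}_{m,n;k,l}$ is bounded in absolute value by $$K\,\theta^{-3/2}\,M^{-i/2}\left(\frac{\exp\Big\{-\frac{c\,p^2}{1+kM^{-i}}-\frac{c\,M^{-i}}{1+k}\big(h-\frac{k}{1+C}\big)^2\Big\}}{1+\sqrt{kM^{-i}}}+e^{-c\,kM^{-i}-c\,p}\right),$$ and every matrix entry of $G^{i,\rm mass}_{m,n;k,l}$ by the same expression with $K\,\theta^{-3/2}M^{-i/2}$ replaced by $K\,|\mu|\,\theta^{-2}M^{-i}$. The same bounds hold with $w$ replaced by the constant $1$. (The commutator part vanishes unless $k=m+h+p\pm1$, the mass part unless $k=m+h+p$.) -/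

import Mathlib

/-- `C = (1 - Ω)² / (4 Ω)`. -/
noncomputable def gnC (Ω : ℝ) : ℝ := (1 - Ω) ^ 2 / (4 * Ω)

/-- `Ω̃ = 2 Ω / θ`. -/
noncomputable def gnOmegaTilde (Ω θ : ℝ) : ℝ := 2 * Ω / θ

/-- The combinatorial factor
`√(m! (m+h)! l! (l+h)!) / ((m-u)! (l-u)! (h+u)! u!)`, with `n = m + h` and `k = l + h`
(`h` may be negative). It is only used for `max (0, -h) ≤ u ≤ min (m, l)`, where none of the
subtractions is truncated. -/
noncomputable def gnA (m n k l u : ℕ) : ℝ :=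
  Real.sqrt ((m.factorial : ℝ) * n.factorial * k.factorial * l.factorial) /
    (((m - u).factorial : ℝ) * (l - u).factorial * (n + u - m).factorial * u.factorial)

/-- The matrix elements `Γ^α_{m,n;k,l}` of the Schwinger kernel at `B = Ω`. They vanish unless
`n - m = k - l`; if `n = m + h` and `k = l + h` they are
`(√(1-α)/(1+Cα))^(m+l+h) (1-α)^(-h/2) ∑_u A(m,l,h,u) (Cα(1+Ω)/(√(1-α)(1-Ω)))^(m+l-2u)`,
`u` running from `max (0, -h)` to `min (m, l)`; note that `m + l + h = m + k`, and that `m - n` is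
the truncated subtraction `max (0, -h)`. -/
noncomputable def gnGamma (Ω α : ℝ) (m n k l : ℕ) : ℝ :=
  if m + k = n + l then
    (Real.sqrt (1 - α) / (1 + gnC Ω * α)) ^ (m + k) * (1 - α) ^ (-((n : ℝ) - (m : ℝ)) / 2) *
      ∑ u ∈ Finset.Icc (m - n) (min m l),
        gnA m n k l u *
          (gnC Ω * α * (1 + Ω) / (Real.sqrt (1 - α) * (1 - Ω))) ^ (m + l - 2 * u)
  else 0

/-- The matrix elements of the commutator `[x⁰, Γ]`. A term with a lowered index `j - 1` carries
the factor `√j`, hence is absent for `j = 0`. -/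
noncomputable def gnComm0 (θ : ℝ) (Γ : ℕ → ℕ → ℕ → ℕ → ℝ) (m n k l : ℕ) : ℂ :=
  ((2 * Real.pi * θ * Real.sqrt (θ / 8) : ℝ) : ℂ) *
    ((Real.sqrt (m + 1) * Γ (m + 1) n k l - Real.sqrt l * Γ m n k (l - 1)
      + Real.sqrt m * Γ (m - 1) n k l - Real.sqrt (l + 1) * Γ m n k (l + 1)
      + Real.sqrt (n + 1) * Γ m (n + 1) k l - Real.sqrt k * Γ m n (k - 1) l
      + Real.sqrt n * Γ m (n - 1) k l - Real.sqrt (k + 1) * Γ m n (k + 1) l : ℝ) : ℂ)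

/-- The matrix elements of the commutator `[x¹, Γ]`. -/
noncomputable def gnComm1 (θ : ℝ) (Γ : ℕ → ℕ → ℕ → ℕ → ℝ) (m n k l : ℕ) : ℂ :=
  Complex.I * ((2 * Real.pi * θ * Real.sqrt (θ / 8) : ℝ) : ℂ) *
    ((Real.sqrt (m + 1) * Γ (m + 1) n k l - Real.sqrt l * Γ m n k (l - 1)
      - Real.sqrt m * Γ (m - 1) n k l + Real.sqrt (l + 1) * Γ m n k (l + 1)
      - Real.sqrt (n + 1) * Γ m (n + 1) k l + Real.sqrt k * Γ m n (k - 1) l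
      + Real.sqrt n * Γ m (n - 1) k l - Real.sqrt (k + 1) * Γ m n (k + 1) l : ℝ) : ℂ)

/-- Euclidean gamma matrices in dimension two, normalized by `γ^μ γ^ν + γ^ν γ^μ = -2 δ^{μν}`
(so that the square of `-i γ^ν ∂_ν` is `∂_ν ∂_ν`, that is, minus the square of the momentum);
they are skew-Hermitian. -/
structure IsGammaPair (γ0 γ1 : Matrix (Fin 2) (Fin 2) ℂ) : Prop where
  sq_zero : γ0 * γ0 = -1
  sq_one : γ1 * γ1 = -1
  anticomm : γ0 * γ1 + γ1 * γ0 = 0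
  skew_zero : γ0.conjTranspose = -γ0
  skew_one : γ1.conjTranspose = -γ1

/-- `[γ·x, Γ] = γ⁰ [x⁰, Γ] + γ¹ [x¹, Γ]`. -/
noncomputable def gnSlashComm (θ : ℝ) (γ0 γ1 : Matrix (Fin 2) (Fin 2) ℂ)
    (Γ : ℕ → ℕ → ℕ → ℕ → ℝ) (m n k l : ℕ) : Matrix (Fin 2) (Fin 2) ℂ :=
  gnComm0 θ Γ m n k l • γ0 + gnComm1 θ Γ m n k l • γ1

/-- `[γ·x̃, Γ]` where `x̃ = 2 Θ⁻¹ x` and `Θ = !![0, θ; -θ, 0]`, that is,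
`x̃⁰ = -(2/θ) x¹` and `x̃¹ = (2/θ) x⁰`. -/
noncomputable def gnSlashTildeComm (θ : ℝ) (γ0 γ1 : Matrix (Fin 2) (Fin 2) ℂ)
    (Γ : ℕ → ℕ → ℕ → ℕ → ℝ) (m n k l : ℕ) : Matrix (Fin 2) (Fin 2) ℂ :=
  ((2 / θ : ℝ) : ℂ) • (-(gnComm1 θ Γ m n k l) • γ0 + gnComm0 θ Γ m n k l • γ1)

/-- The spin factor `(2-α)/(2√(1-α)) 1 - i α/(2√(1-α)) γ⁰γ¹`. -/
noncomputable def gnSpin (α : ℝ) (γ0 γ1 : Matrix (Fin 2) (Fin 2) ℂ) :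
    Matrix (Fin 2) (Fin 2) ℂ :=
  (((2 - α) / (2 * Real.sqrt (1 - α)) : ℝ) : ℂ) • (1 : Matrix (Fin 2) (Fin 2) ℂ)
    - (Complex.I * ((α / (2 * Real.sqrt (1 - α)) : ℝ) : ℂ)) • (γ0 * γ1)

/-- The commutator part `G^{α,comm}_{m,n;k,l}` of the propagator at parameter `α`. -/
noncomputable def gnAlphaComm (Ω θ α : ℝ) (γ0 γ1 : Matrix (Fin 2) (Fin 2) ℂ) (m n k l : ℕ) :
    Matrix (Fin 2) (Fin 2) ℂ :=
  ((Complex.I * ((gnOmegaTilde Ω θ * ((2 - α) / α) : ℝ) : ℂ)) •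
        gnSlashComm θ γ0 γ1 (gnGamma Ω α) m n k l
      + (Ω : ℂ) • gnSlashTildeComm θ γ0 γ1 (gnGamma Ω α) m n k l) * gnSpin α γ0 γ1

/-- The mass part `G^{α,mass}_{m,n;k,l}` of the propagator at parameter `α`. -/
noncomputable def gnAlphaMass (Ω μ α : ℝ) (γ0 γ1 : Matrix (Fin 2) (Fin 2) ℂ) (m n k l : ℕ) :
    Matrix (Fin 2) (Fin 2) ℂ :=
  ((-μ * gnGamma Ω α m n k l : ℝ) : ℂ) • gnSpin α γ0 γ1

/-- The scalar factor `(1-α)^(μ²θ/(8Ω) - 1/2) / (1 + Cα)` of the Schwinger representation. -/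
noncomputable def gnWeight (Ω θ μ α : ℝ) : ℝ :=
  (1 - α) ^ (μ ^ 2 * θ / (8 * Ω) - 1 / 2) / (1 + gnC Ω * α)

/-- The slice `-(2Ω/(θ²π²)) ∫_{M^{-i}}^{M^{-i+1}} w(α) G^α dα` of a spinor-matrix valued function
`G`, with scalar weight `w`; the integral is taken entry by entry. -/
noncomputable def gnSlice (Ω θ M : ℝ) (i : ℕ) (w : ℝ → ℝ)
    (G : ℝ → Matrix (Fin 2) (Fin 2) ℂ) : Matrix (Fin 2) (Fin 2) ℂ :=
  Matrix.of fun a b =>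
    ((-(2 * Ω / (θ ^ 2 * Real.pi ^ 2)) : ℝ) : ℂ) *
      ∫ α in (M ^ (-(i : ℝ)))..(M ^ (-(i : ℝ) + 1)), (w α : ℂ) * G α a b

/-- The commutator part `G^{i,comm}_{m,n;k,l}` of the propagator in the slice `i`. -/
noncomputable def gnSliceComm (Ω θ M : ℝ) (i : ℕ) (w : ℝ → ℝ)
    (γ0 γ1 : Matrix (Fin 2) (Fin 2) ℂ) (m n k l : ℕ) : Matrix (Fin 2) (Fin 2) ℂ :=
  gnSlice Ω θ M i w fun α => gnAlphaComm Ω θ α γ0 γ1 m n k l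

/-- The mass part `G^{i,mass}_{m,n;k,l}` of the propagator in the slice `i`. -/
noncomputable def gnSliceMass (Ω θ μ M : ℝ) (i : ℕ) (w : ℝ → ℝ)
    (γ0 γ1 : Matrix (Fin 2) (Fin 2) ℂ) (m n k l : ℕ) : Matrix (Fin 2) (Fin 2) ℂ :=
  gnSlice Ω θ M i w fun α => gnAlphaMass Ω μ α γ0 γ1 m n k l

/-- The profile
`exp (-c p²/(1+kM^{-i}) - c M^{-i} (h - k/(1+C))²/(1+k)) / (1+√(kM^{-i})) + exp (-c k M^{-i} - c p)`.
-/
noncomputable def gnBound (Ω M c : ℝ) (i k h p : ℕ) : ℝ :=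
  Real.exp (-(c * (p : ℝ) ^ 2 / (1 + k * M ^ (-(i : ℝ))))
      - c * M ^ (-(i : ℝ)) / (1 + k) * ((h : ℝ) - k / (1 + gnC Ω)) ^ 2) /
    (1 + Real.sqrt (k * M ^ (-(i : ℝ))))
  + Real.exp (-(c * k * M ^ (-(i : ℝ))) - c * p)

/-! Put δ = α/(1+Cα), r = (1+C)δ and q = Cδ. Since 1-r = (1-α)/(1+Cα), 1-q = 1/(1+Cα) and
(C(1+Ω)/(1-Ω))² = C(1+C), the square of each term of Γ^α is a product of four binomial
probabilities: Bin(m,r) and Bin(n,q) at m-u, Bin(l,r) and Bin(k,q) at l-u (`gnGamma_term_eq`). So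
Γ^α measures the overlap of four nearly Poisson laws.

Each law may be tilted by exp(t_j v). If the rates t_j add up to zero, the summation variable u
drops out and only a factor exponential in l-m is left. Two of the tilted laws are bounded
pointwise, with a gain (1+mean)^(-1/2) each before the square root is taken; the other two are
summed by Cauchy–Schwarz (`HasPoissonBounds.sum_sqrt_mul_le`). The rates keep two free parameters: τ
produces decay in p = l-m, and λ, chosen optimally, produces a Gaussian in the mismatch of means Δ =
(m+l)r - (n+k)q. Up to controlled terms, Δ is a multiple of δ(h - k/(1+C)). For p ≤ 1+kα this gives
the first term of the profile, the pointwise gains supplying 1/(1+√(kα)); for larger p, linear decay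
in p also pays for kα and gives the second term (`KernelRange.sum_le`).

The selection rule and the symmetry of Γ reduce both commutators to two copies of `lowerComm`. Its
terms cancel in pairs: each pair is a sum of the same square roots, weighted by the deviation of a
binomial variable from its mean over √N. This deviation is worth √r ~ √α times the square root of a
weight that still satisfies Poisson-type bounds. The factor 1/α in the commutator part thus becomes
α^(-1/2), and a slice of length O(M^(-i)) yields M^(-i/2); the mass part has no such factor and
yields M^(-i). -/

/-! ### Binomial weights: exponential moments and local bound -/

/-- The binomial weight `choose N v * r ^ v * (1 - r) ^ (N - v)`. -/
noncomputable def binomWeight (N : ℕ) (r : ℝ) (v : ℕ) : ℝ :=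
  (N.choose v : ℝ) * r ^ v * (1 - r) ^ (N - v)

lemma binomWeight_nonneg {r : ℝ} (h0 : 0 ≤ r) (h1 : r ≤ 1) (N v : ℕ) :
    0 ≤ binomWeight N r v := by
  have : 0 ≤ 1 - r := by linarith
  unfold binomWeight
  positivity

lemma binomWeight_eq_zero {N v : ℕ} (h : N < v) (r : ℝ) : binomWeight N r v = 0 := by
  simp [binomWeight, Nat.choose_eq_zero_of_lt h]

lemma sum_binomWeight_mul_exp (N : ℕ) (r t : ℝ) :
    ∑ v ∈ Finset.range (N + 1), binomWeight N r v * Real.exp (t * v) =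
      (1 - r + r * Real.exp t) ^ N := by
  rw [add_comm (1 - r), add_pow]
  refine Finset.sum_congr rfl fun v _ => ?_
  rw [binomWeight, mul_comm t, Real.exp_nat_mul, mul_pow]
  ring

lemma sum_range_binomWeight_mul_exp_le {r : ℝ} (h0 : 0 ≤ r) (h1 : r ≤ 1) (N n : ℕ) (t : ℝ) :
    ∑ v ∈ Finset.range n, binomWeight N r v * Real.exp (t * v) ≤
      (1 - r + r * Real.exp t) ^ N := by
  rw [← sum_binomWeight_mul_exp, ← Finset.sum_filter_of_ne (p := fun v => v < N + 1)]
  · refine Finset.sum_le_sum_of_subset_of_nonneg (fun v hv => ?_) fun v _ _ =>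
      mul_nonneg (binomWeight_nonneg h0 h1 N v) (Real.exp_pos _).le
    exact Finset.mem_range.2 (Finset.mem_filter.1 hv).2
  · intro v _ hv
    by_contra h
    exact hv (by rw [binomWeight_eq_zero (by omega), zero_mul])

lemma generating_pow_le_exp {r t : ℝ} (h0 : 0 ≤ r) (h1 : r ≤ 1) (ht : |t| ≤ 1) (N : ℕ) :
    (1 - r + r * Real.exp t) ^ N ≤ Real.exp (N * r * t + N * r * t ^ 2) := by
  have he := (abs_le.1 (Real.abs_exp_sub_one_sub_id_le ht)).2
  have h2 : 1 - r + r * Real.exp t ≤ Real.exp (r * t + r * t ^ 2) := by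
    have := Real.add_one_le_exp (r * t + r * t ^ 2)
    nlinarith
  have h3 : 0 ≤ 1 - r + r * Real.exp t := by
    have := mul_nonneg h0 (Real.exp_pos t).le
    linarith
  calc _ ≤ Real.exp (r * t + r * t ^ 2) ^ N := pow_le_pow_left₀ h3 h2 N
    _ = _ := by rw [← Real.exp_nat_mul]; congr 1; ring

lemma binomWeight_le_one {r : ℝ} (h0 : 0 ≤ r) (h1 : r ≤ 1) (N v : ℕ) :
    binomWeight N r v ≤ 1 := by
  have h := sum_range_binomWeight_mul_exp_le h0 h1 N (v + 1) 0
  have h2 := Finset.single_le_sum (f := fun v : ℕ => binomWeight N r v * Real.exp (0 * v))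
    (fun v _ => mul_nonneg (binomWeight_nonneg h0 h1 N v) (Real.exp_pos _).le)
    (Finset.mem_range.2 (Nat.lt_succ_self v))
  simp only [zero_mul, Real.exp_zero, mul_one, sub_add_cancel, one_pow] at h h2
  exact h2.trans h

lemma integral_exp_int_mul_I (d : ℤ) (hd : d ≠ 0) :
    ∫ x in (-Real.pi)..Real.pi, Complex.exp ((d * Complex.I) * (x : ℂ)) = 0 := by
  rw [integral_exp_mul_complex (by simp [hd])]
  have : Complex.exp (d * Complex.I * (Real.pi : ℝ)) =
      Complex.exp (d * Complex.I * ((-Real.pi : ℝ) : ℂ)) := by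
    rw [Complex.exp_eq_exp_iff_exists_int]
    exact ⟨d, by push_cast; ring⟩
  rw [this, sub_self, zero_div]

/-- Fourier inversion: the weights are the coefficients of the characteristic function (1-s+s
e^{ix})^N. -/
lemma two_pi_mul_binomWeight (N : ℕ) (s : ℝ) (v : ℕ) :
    ∫ x in (-Real.pi)..Real.pi, (((1 - s : ℝ) : ℂ) + (s : ℂ) * Complex.exp (x * Complex.I)) ^ N *
      Complex.exp (-(v * x * Complex.I)) = ((2 * Real.pi * binomWeight N s v : ℝ) : ℂ) := by
  have hexp : ∀ x : ℝ, (((1 - s : ℝ) : ℂ) + (s : ℂ) * Complex.exp (x * Complex.I)) ^ N *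
      Complex.exp (-(v * x * Complex.I)) = ∑ j ∈ Finset.range (N + 1),
        (binomWeight N s j : ℂ) * Complex.exp ((((j : ℤ) - (v : ℤ) : ℤ) * Complex.I) * x) := by
    intro x
    rw [add_comm, add_pow, Finset.sum_mul]
    refine Finset.sum_congr rfl fun j _ => ?_
    have : Complex.exp ((((j : ℤ) - (v : ℤ) : ℤ) * Complex.I) * x) =
        Complex.exp (x * Complex.I) ^ j * Complex.exp (-(v * x * Complex.I)) := by
      rw [← Complex.exp_nat_mul, ← Complex.exp_add]
      congr 1
      push_cast
      ring
    rw [this, mul_pow, binomWeight]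
    push_cast
    ring
  simp_rw [hexp]
  rw [intervalIntegral.integral_finsetSum fun j _ =>
    (Continuous.intervalIntegrable (by fun_prop) _ _)]
  simp_rw [intervalIntegral.integral_const_mul]
  rw [Finset.sum_eq_single v]
  · simp
    ring
  · intro j _ hj
    rw [integral_exp_int_mul_I _ (by omega), mul_zero]
  · intro h
    rw [binomWeight_eq_zero (by simpa using h)]
    simp

/-- The squared modulus of the base is 1 - 2s(1-s)(1-cos x). Here 2(1-s) ≥ 1 because s ≤ 1/2, and
1-cos x ≥ 2x²/π² on [-π,π]. -/
lemma norm_generating_pow_le {s x : ℝ} (h0 : 0 ≤ s) (h1 : s ≤ 1 / 2) (hx : |x| ≤ Real.pi) (N : ℕ) :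
    ‖(((1 - s : ℝ) : ℂ) + (s : ℂ) * Complex.exp (x * Complex.I)) ^ N‖ ≤
      Real.exp (-(N * s / Real.pi ^ 2) * x ^ 2) := by
  have hcos := Real.cos_le_one_sub_mul_cos_sq hx
  have hsq : ‖((1 - s : ℝ) : ℂ) + (s : ℂ) * Complex.exp (x * Complex.I)‖ ^ 2 ≤
      Real.exp (-(s / Real.pi ^ 2) * x ^ 2) ^ 2 := by
    have e1 : ((1 - s : ℝ) : ℂ) + (s : ℂ) * Complex.exp (x * Complex.I) =
        ((1 - s + s * Real.cos x : ℝ) : ℂ) + ((s * Real.sin x : ℝ) : ℂ) * Complex.I := by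
      rw [Complex.exp_mul_I]
      push_cast
      ring
    have e2 : ‖((1 - s : ℝ) : ℂ) + (s : ℂ) * Complex.exp (x * Complex.I)‖ ^ 2 =
        1 - 2 * s * (1 - s) * (1 - Real.cos x) := by
      rw [e1, Complex.sq_norm, Complex.normSq_add_mul_I]
      linear_combination s ^ 2 * Real.sin_sq_add_cos_sq x
    rw [e2, ← Real.exp_nat_mul]
    have h3 := Real.add_one_le_exp (((2 : ℕ) : ℝ) * (-(s / Real.pi ^ 2) * x ^ 2))
    refine le_trans ?_ h3
    push_cast
    have h4 : 0 ≤ 1 - Real.cos x := by linarith [Real.cos_le_one x]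
    have h5 : s * (1 - Real.cos x) ≤ 2 * s * (1 - s) * (1 - Real.cos x) := by
      have : 0 ≤ s * (1 - Real.cos x) := mul_nonneg h0 h4
      nlinarith
    have h6 : s * (2 / Real.pi ^ 2 * x ^ 2) ≤ s * (1 - Real.cos x) :=
      mul_le_mul_of_nonneg_left (by linarith) h0
    have h7 : s * (2 / Real.pi ^ 2 * x ^ 2) = 2 * (s / Real.pi ^ 2 * x ^ 2) := by ring
    linarith
  have h := abs_le_of_sq_le_sq hsq (Real.exp_pos _).le
  rw [abs_of_nonneg (norm_nonneg _)] at h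
  rw [norm_pow]
  calc _ ≤ Real.exp (-(s / Real.pi ^ 2) * x ^ 2) ^ N := pow_le_pow_left₀ (norm_nonneg _) h N
    _ = _ := by rw [← Real.exp_nat_mul]; congr 1; ring

/-- The local bound: comparing the Fourier integral with a Gaussian one gives (weight)²·Ns ≤ π/4 ≤
1, and the trivial bound by 1 covers small Ns. -/
lemma binomWeight_mul_sqrt_le {s : ℝ} (h0 : 0 ≤ s) (h1 : s ≤ 1 / 2) (N v : ℕ) :
    binomWeight N s v * Real.sqrt (1 + N * s) ≤ 2 := by
  have hb1 := binomWeight_le_one h0 (by linarith) N v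
  have hb0 := binomWeight_nonneg h0 (by linarith) N v
  rcases eq_or_lt_of_le (mul_nonneg (Nat.cast_nonneg (α := ℝ) N) h0) with h | h
  · rw [← h]; simp; linarith
  have hb : 0 < N * s / Real.pi ^ 2 := by positivity
  have hint : 2 * Real.pi * binomWeight N s v ≤ Real.sqrt (Real.pi / (N * s / Real.pi ^ 2)) := by
    rw [← integral_gaussian]
    calc 2 * Real.pi * binomWeight N s v
        = ‖((2 * Real.pi * binomWeight N s v : ℝ) : ℂ)‖ := by
          rw [Complex.norm_real, Real.norm_of_nonneg]; positivity
      _ ≤ ∫ x in (-Real.pi)..Real.pi, ‖(((1 - s : ℝ) : ℂ) +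
            (s : ℂ) * Complex.exp (x * Complex.I)) ^ N * Complex.exp (-(v * x * Complex.I))‖ := by
          rw [← two_pi_mul_binomWeight]
          exact intervalIntegral.norm_integral_le_integral_norm (by linarith [Real.pi_pos])
      _ ≤ ∫ x in (-Real.pi)..Real.pi, Real.exp (-(N * s / Real.pi ^ 2) * x ^ 2) := by
          refine intervalIntegral.integral_mono_on (by linarith [Real.pi_pos])
            (Continuous.intervalIntegrable (by fun_prop) _ _)
            (Continuous.intervalIntegrable (by fun_prop) _ _) fun x hx => ?_
          rw [norm_mul, show -((v : ℂ) * x * Complex.I) = ((-(v * x) : ℝ) : ℂ) * Complex.I by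
            push_cast; ring, Complex.norm_exp_ofReal_mul_I, mul_one]
          exact norm_generating_pow_le h0 h1 (abs_le.2 hx) N
      _ ≤ ∫ x, Real.exp (-(N * s / Real.pi ^ 2) * x ^ 2) := by
          rw [intervalIntegral.integral_of_le (by linarith [Real.pi_pos])]
          exact MeasureTheory.setIntegral_le_integral (integrable_exp_neg_mul_sq hb)
            (Filter.Eventually.of_forall fun x => (Real.exp_pos _).le)
  have hsq : (2 * Real.pi * binomWeight N s v) ^ 2 ≤ Real.pi ^ 3 / (N * s) := by
    calc _ ≤ Real.sqrt (Real.pi / (N * s / Real.pi ^ 2)) ^ 2 :=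
          pow_le_pow_left₀ (by positivity) hint 2
      _ = _ := by rw [Real.sq_sqrt (by positivity)]; field_simp
  rw [le_div_iff₀ h] at hsq
  have hpi : Real.pi ^ 2 * (4 * (binomWeight N s v ^ 2 * (N * s))) ≤ Real.pi ^ 2 * 4 := by
    have := Real.pi_le_four
    have := Real.pi_pos
    calc _ = (2 * Real.pi * binomWeight N s v) ^ 2 * (N * s) := by ring
      _ ≤ _ := hsq
      _ ≤ _ := by nlinarith [sq_nonneg Real.pi]
  have h3 := le_of_mul_le_mul_left hpi (by positivity)
  refine abs_le_of_sq_le_sq' ?_ (by norm_num) |>.2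
  rw [mul_pow, Real.sq_sqrt (by positivity)]
  nlinarith

/-! ### Weights with Poisson-type bounds -/

/-- A nonnegative weight on `ℕ` whose exponential moments and exponentially tilted values are
controlled, up to the constant `L`, like those of a Poisson law of mean `μ`. -/
structure HasPoissonBounds (L μ : ℝ) (P : ℕ → ℝ) : Prop where
  nonneg : ∀ v, 0 ≤ P v
  sum_le : ∀ t : ℝ, |t| ≤ 1 / 2 → ∀ n : ℕ,
    ∑ v ∈ Finset.range n, P v * Real.exp (t * v) ≤ L * Real.exp (μ * t + 2 * μ * t ^ 2)
  le : ∀ t : ℝ, |t| ≤ 1 / 2 → ∀ v : ℕ,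
    P v * Real.exp (t * v) * Real.sqrt (1 + μ) ≤ L * Real.exp (μ * t + 2 * μ * t ^ 2)

/-- A tilted binomial law is D^N times the binomial law with parameter s = r e^t/D, so the untilted
local bound applies to it. The restrictions on r and t keep s ≤ 1/2 and r ≤ 4s, so that the two
means are comparable. -/
lemma binomWeight_mul_exp_le {r t : ℝ} (h0 : 0 ≤ r) (h1 : r ≤ 1 / 10) (ht : |t| ≤ 1) (N v : ℕ) :
    binomWeight N r v * Real.exp (t * v) * Real.sqrt (1 + N * r) ≤
      4 * Real.exp (N * r * t + N * r * t ^ 2) := by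
  have ht' := abs_le.1 ht
  have he1 : Real.exp t ≤ 2.7182818286 :=
    (Real.exp_le_exp.2 ht'.2).trans Real.exp_one_lt_d9.le
  have he2 : 0.36 ≤ Real.exp t := by
    refine le_trans ?_ (Real.exp_le_exp.2 ht'.1)
    linarith [Real.exp_neg_one_gt_d9]
  set D := 1 - r + r * Real.exp t with hD
  have hD0 : 9 / 10 ≤ D := by nlinarith
  have hD1 : D ≤ 1.2 := by nlinarith
  set s := r * Real.exp t / D with hs
  have hs0 : 0 ≤ s := by positivity
  have hs1 : s ≤ 1 / 2 := by
    rw [hs, div_le_iff₀ (by linarith)]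
    nlinarith
  have hrs : r ≤ 4 * s := by
    rw [hs, ← mul_div_assoc, le_div_iff₀ (by linarith)]
    nlinarith
  have htilt : binomWeight N r v * Real.exp (t * v) = D ^ N * binomWeight N s v := by
    rcases lt_or_ge N v with h | h
    · simp [binomWeight_eq_zero h]
    have h1s : 1 - s = (1 - r) / D := by
      rw [hs]
      field_simp
      rw [hD]
      ring
    rw [binomWeight, binomWeight, h1s, hs, div_pow, div_pow, mul_pow, mul_comm t, Real.exp_nat_mul]
    have : D ^ N = D ^ v * D ^ (N - v) := by rw [← pow_add]; congr 1; omega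
    rw [this]
    field_simp
  have hloc := binomWeight_mul_sqrt_le hs0 hs1 N v
  have hb0 := binomWeight_nonneg hs0 (by linarith) N v
  have hN : (N : ℝ) * r ≤ 4 * (N * s) := by
    have := mul_le_mul_of_nonneg_left hrs (Nat.cast_nonneg (α := ℝ) N)
    linarith
  have hsqrt : Real.sqrt (1 + N * r) ≤ 2 * Real.sqrt (1 + N * s) := by
    rw [show (2 : ℝ) = Real.sqrt 4 by rw [show (4 : ℝ) = 2 ^ 2 by norm_num]; simp,
      ← Real.sqrt_mul (by norm_num)]
    exact Real.sqrt_le_sqrt (by linarith)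
  calc _ = D ^ N * (binomWeight N s v * Real.sqrt (1 + N * r)) := by rw [htilt]; ring
    _ ≤ D ^ N * (binomWeight N s v * (2 * Real.sqrt (1 + N * s))) := by gcongr
    _ = D ^ N * (2 * (binomWeight N s v * Real.sqrt (1 + N * s))) := by ring
    _ ≤ D ^ N * (2 * 2) := by gcongr
    _ ≤ Real.exp (N * r * t + N * r * t ^ 2) * (2 * 2) := by
        gcongr
        exact generating_pow_le_exp h0 (by linarith) ht N
    _ = _ := by ring

lemma sum_binomWeight_mul_exp_le {r t : ℝ} (h0 : 0 ≤ r) (h1 : r ≤ 1) (ht : |t| ≤ 1)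
    (N n : ℕ) : ∑ v ∈ Finset.range n, binomWeight N r v * Real.exp (t * v) ≤
      Real.exp (N * r * t + N * r * t ^ 2) :=
  (sum_range_binomWeight_mul_exp_le h0 h1 N n t).trans (generating_pow_le_exp h0 h1 ht N)

lemma HasPoissonBounds.mono {L L' μ : ℝ} {P : ℕ → ℝ} (h : HasPoissonBounds L μ P) (hL : L ≤ L') :
    HasPoissonBounds L' μ P where
  nonneg := h.nonneg
  sum_le t ht n := (h.sum_le t ht n).trans (by gcongr)
  le t ht v := (h.le t ht v).trans (by gcongr)

lemma hasPoissonBounds_binomWeight {r : ℝ} (h0 : 0 ≤ r) (h1 : r ≤ 1 / 10) (N : ℕ) :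
    HasPoissonBounds 4 (N * r) (binomWeight N r) where
  nonneg v := binomWeight_nonneg h0 (by linarith) N v
  sum_le t ht n := by
    refine (sum_binomWeight_mul_exp_le h0 (by linarith) (by linarith) N n).trans ?_
    have : 0 ≤ N * r * t ^ 2 := by positivity
    have h2 : Real.exp (N * r * t + N * r * t ^ 2) ≤ Real.exp (N * r * t + 2 * (N * r) * t ^ 2) :=
      Real.exp_le_exp.2 (by linarith)
    linarith [Real.exp_pos (N * r * t + 2 * (N * r) * t ^ 2)]
  le t ht v := by
    refine (binomWeight_mul_exp_le h0 h1 (by linarith) N v).trans ?_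
    have : 0 ≤ N * r * t ^ 2 := by positivity
    have h2 : Real.exp (N * r * t + N * r * t ^ 2) ≤ Real.exp (N * r * t + 2 * (N * r) * t ^ 2) :=
      Real.exp_le_exp.2 (by linarith)
    linarith

/-- For a mean at most 1 the Gaussian exponential is at least 1/2 and √(1+μ) at most 2, so the local
bound follows from the moment bound by keeping one term. -/
lemma HasPoissonBounds.of_sum_le {L μ : ℝ} {P : ℕ → ℝ} (hμ0 : 0 ≤ μ) (hμ1 : μ ≤ 1)
    (h0 : ∀ v, 0 ≤ P v)
    (h : ∀ t : ℝ, |t| ≤ 1 / 2 → ∀ n : ℕ, ∑ v ∈ Finset.range n, P v * Real.exp (t * v) ≤ L) :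
    HasPoissonBounds (4 * L) μ P := by
  have hL : 0 ≤ L := by simpa using h 0 (by norm_num) 0
  have hexp : ∀ t : ℝ, |t| ≤ 1 / 2 → 1 / 2 ≤ Real.exp (μ * t + 2 * μ * t ^ 2) := by
    intro t ht
    have ht' := abs_le.1 ht
    have := Real.add_one_le_exp (μ * t + 2 * μ * t ^ 2)
    have : 0 ≤ μ * t ^ 2 := by positivity
    nlinarith
  have hs : Real.sqrt (1 + μ) ≤ 2 := by
    rw [Real.sqrt_le_left (by norm_num)]
    linarith
  refine ⟨h0, fun t ht n => (h t ht n).trans ?_, fun t ht v => ?_⟩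
  · nlinarith [hexp t ht]
  · have h2 := Finset.single_le_sum (f := fun v : ℕ => P v * Real.exp (t * v))
      (fun v _ => mul_nonneg (h0 v) (Real.exp_pos _).le) (Finset.mem_range.2 (Nat.lt_succ_self v))
    have h3 : P v * Real.exp (t * v) ≤ L := h2.trans (h t ht _)
    have h4 : 0 ≤ P v * Real.exp (t * v) := mul_nonneg (h0 v) (Real.exp_pos _).le
    nlinarith [hexp t ht, Real.sqrt_nonneg (1 + μ)]

/-! ### Binomial weights with a squared deviation -/

/-- The binomial weight multiplied by the squared deviation from its mean, in units of the mean. -/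
noncomputable def deviationWeight (N : ℕ) (r : ℝ) (v : ℕ) : ℝ :=
  ((v : ℝ) - N * r) ^ 2 / (N * r) * binomWeight N r v

lemma deviationWeight_nonneg {r : ℝ} (h0 : 0 ≤ r) (h1 : r ≤ 1) (N v : ℕ) :
    0 ≤ deviationWeight N r v := by
  have := binomWeight_nonneg h0 h1 N v
  unfold deviationWeight
  positivity

lemma sq_le_four_mul_exp_add_exp (x : ℝ) :
    x ^ 2 ≤ 4 * (Real.exp (x / 2) + Real.exp (-(x / 2))) := by
  have h1 := Real.quadratic_le_exp_of_nonneg (x := |x / 2| / 2) (by positivity)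
  have h2 : Real.exp (|x / 2| / 2) ^ 2 = Real.exp |x / 2| := by
    rw [← Real.exp_nat_mul]
    congr 1
    push_cast
    ring
  have h3 : Real.exp |x / 2| ≤ Real.exp (x / 2) + Real.exp (-(x / 2)) := by
    rcases abs_choice (x / 2) with h | h <;> rw [h]
    · linarith [Real.exp_pos (-(x / 2))]
    · linarith [Real.exp_pos (x / 2)]
  have h4 : |x / 2| ^ 2 ≤ Real.exp |x / 2| := by
    rw [← h2]
    have h0 := abs_nonneg (x / 2)
    refine pow_le_pow_left₀ h0 (le_trans ?_ h1) 2
    nlinarith [sq_nonneg (|x / 2| - 2)]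
  rw [sq_abs] at h4
  linarith

lemma succ_mul_binomWeight_succ (N v : ℕ) (r : ℝ) :
    ((v : ℝ) + 1) * binomWeight (N + 1) r (v + 1) = (N + 1) * r * binomWeight N r v := by
  have h : ((N : ℝ) + 1) * N.choose v = (N + 1).choose (v + 1) * (v + 1) := by
    exact_mod_cast Nat.add_one_mul_choose_eq N v
  rw [binomWeight, binomWeight, pow_succ, Nat.add_sub_add_right]
  linear_combination -r ^ v * r * (1 - r) ^ (N - v) * h

/-- The square of the normalized deviation is dominated by two exponentials, which act as additional
tilts ±s, with s half the inverse of √(Nr). -/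
lemma deviationWeight_mul_exp_le {N : ℕ} {r : ℝ} (h0 : 0 < r) (h1 : r ≤ 1) (hN : 1 ≤ N * r)
    (t : ℝ) (v : ℕ) :
    ∃ s : ℝ, s = 1 / (2 * Real.sqrt (N * r)) ∧ deviationWeight N r v * Real.exp (t * v) ≤
      4 * Real.exp (-(s * (N * r))) * (binomWeight N r v * Real.exp ((t + s) * v)) +
      4 * Real.exp (s * (N * r)) * (binomWeight N r v * Real.exp ((t - s) * v)) := by
  refine ⟨_, rfl, ?_⟩
  set s := 1 / (2 * Real.sqrt (N * r)) with hs
  have hb := binomWeight_nonneg h0.le h1 N v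
  have hq : 0 < Real.sqrt (N * r) := Real.sqrt_pos.2 (by linarith)
  have hx := sq_le_four_mul_exp_add_exp (((v : ℝ) - N * r) / Real.sqrt (N * r))
  rw [div_pow, Real.sq_sqrt (by linarith)] at hx
  have e1 : ((v : ℝ) - N * r) / Real.sqrt (N * r) / 2 = s * v - s * (N * r) := by
    rw [hs]; field_simp
  rw [e1] at hx
  have hE : 0 ≤ binomWeight N r v * Real.exp (t * v) := mul_nonneg hb (Real.exp_pos _).le
  calc deviationWeight N r v * Real.exp (t * v)
      = ((v : ℝ) - N * r) ^ 2 / (N * r) * (binomWeight N r v * Real.exp (t * v)) := by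
        rw [deviationWeight]; ring
    _ ≤ _ := mul_le_mul_of_nonneg_right hx hE
    _ = _ := by
      rw [show (t + s) * (v : ℝ) = t * v + s * v by ring,
        show (t - s) * (v : ℝ) = t * v + -(s * v) by ring,
        show s * (v : ℝ) - s * (N * r) = s * v + -(s * (N * r)) by ring,
        show -(s * (v : ℝ) + -(s * (N * r))) = -(s * v) + s * (N * r) by ring]
      simp only [Real.exp_add]
      ring

lemma hasPoissonBounds_deviationWeight_of_one_le {N : ℕ} {r : ℝ} (h0 : 0 < r) (h1 : r ≤ 1 / 10)
    (hN : 1 ≤ N * r) : HasPoissonBounds 64 (N * r) (deviationWeight N r) := by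
  obtain ⟨s, hs⟩ : ∃ s, s = 1 / (2 * Real.sqrt (N * r)) := ⟨_, rfl⟩
  have hq : 1 ≤ Real.sqrt (N * r) := Real.one_le_sqrt.2 hN
  have hs0 : 0 ≤ s := by rw [hs]; positivity
  have hs1 : s ≤ 1 / 2 := by
    rw [hs]
    exact one_div_le_one_div_of_le (by norm_num) (by linarith)
  have hs2 : N * r * s ^ 2 = 1 / 4 := by
    rw [hs, div_pow, mul_pow, Real.sq_sqrt (by linarith)]
    have : (N : ℝ) * r ≠ 0 := by linarith
    generalize (N : ℝ) * r = x at this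
    field_simp
    norm_num
  have he : Real.exp (1 / 2) ≤ 2 := by
    have := Real.exp_one_lt_d9
    have h2 : Real.exp (1 / 2) ^ 2 = Real.exp 1 := by
      rw [← Real.exp_nat_mul]; norm_num
    nlinarith [Real.exp_pos (1 / 2)]
  -- By (t+σ)² ≤ 2t² + 2σ², the extra tilt costs only 2Nrσ² = 1/2 in the exponent. This is why
  -- `HasPoissonBounds` carries 2μt² instead of μt², and why it stops at |t| ≤ 1/2: the shifted
  -- rates must stay in [-1,1].
  have key : ∀ t : ℝ, ∀ σ : ℝ, σ ^ 2 = s ^ 2 →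
      Real.exp (-(σ * (N * r))) * Real.exp (N * r * (t + σ) + N * r * (t + σ) ^ 2) ≤
        2 * Real.exp (N * r * t + 2 * (N * r) * t ^ 2) := by
    intro t σ hσ
    rw [← Real.exp_add]
    calc _ ≤ Real.exp (1 / 2 + (N * r * t + 2 * (N * r) * t ^ 2)) := by
          refine Real.exp_le_exp.2 ?_
          have h3 : 0 ≤ N * r * (t - σ) ^ 2 := by positivity
          have h4 : N * r * σ ^ 2 = 1 / 4 := by rw [hσ, hs2]
          nlinarith
      _ ≤ _ := by rw [Real.exp_add]; gcongr
  have bnd : ∀ t : ℝ, |t| ≤ 1 / 2 → |t + s| ≤ 1 ∧ |t + -s| ≤ 1 := by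
    intro t ht
    have := abs_le.1 ht
    constructor <;> rw [abs_le] <;> constructor <;> linarith
  refine ⟨fun v => deviationWeight_nonneg h0.le (by linarith) N v, fun t ht n => ?_,
    fun t ht v => ?_⟩
  · have k1 := key t s rfl
    have k2 := key t (-s) (by ring)
    have s1 := sum_binomWeight_mul_exp_le h0.le (by linarith) (bnd t ht).1 N n
    have s2 := sum_binomWeight_mul_exp_le h0.le (by linarith) (bnd t ht).2 N n
    have hE := Real.exp_pos (N * r * t + 2 * (N * r) * t ^ 2)
    calc _ ≤ ∑ v ∈ Finset.range n,
          (4 * Real.exp (-(s * (N * r))) * (binomWeight N r v * Real.exp ((t + s) * v)) +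
          4 * Real.exp (-(-s * (N * r))) * (binomWeight N r v * Real.exp ((t + -s) * v))) := by
          refine Finset.sum_le_sum fun v _ => ?_
          obtain ⟨s', hs', h⟩ := deviationWeight_mul_exp_le h0 (by linarith) hN t v
          rw [hs', ← hs] at h
          rwa [neg_mul, neg_neg, ← sub_eq_add_neg]
      _ = 4 * (Real.exp (-(s * (N * r))) *
            ∑ v ∈ Finset.range n, binomWeight N r v * Real.exp ((t + s) * v)) +
          4 * (Real.exp (-(-s * (N * r))) *
            ∑ v ∈ Finset.range n, binomWeight N r v * Real.exp ((t + -s) * v)) := by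
          rw [Finset.sum_add_distrib, ← Finset.mul_sum, ← Finset.mul_sum]
          ring
      _ ≤ 4 * (Real.exp (-(s * (N * r))) * Real.exp (N * r * (t + s) + N * r * (t + s) ^ 2)) +
          4 * (Real.exp (-(-s * (N * r))) *
            Real.exp (N * r * (t + -s) + N * r * (t + -s) ^ 2)) := by gcongr
      _ ≤ _ := by linarith
  · have k1 := key t s rfl
    have k2 := key t (-s) (by ring)
    have s1 := binomWeight_mul_exp_le h0.le h1 (bnd t ht).1 N v
    have s2 := binomWeight_mul_exp_le h0.le h1 (bnd t ht).2 N v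
    obtain ⟨s', hs', h⟩ := deviationWeight_mul_exp_le h0 (by linarith) hN t v
    rw [hs', ← hs, sub_eq_add_neg] at h
    calc _ ≤ (4 * Real.exp (-(s * (N * r))) * (binomWeight N r v * Real.exp ((t + s) * v)) +
          4 * Real.exp (s * (N * r)) * (binomWeight N r v * Real.exp ((t + -s) * v))) *
            Real.sqrt (1 + N * r) := by gcongr
      _ = 4 * (Real.exp (-(s * (N * r))) *
            (binomWeight N r v * Real.exp ((t + s) * v) * Real.sqrt (1 + N * r))) +
          4 * (Real.exp (-(-s * (N * r))) *
            (binomWeight N r v * Real.exp ((t + -s) * v) * Real.sqrt (1 + N * r))) := by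
          rw [neg_mul, neg_neg]; ring
      _ ≤ 4 * (Real.exp (-(s * (N * r))) *
            (4 * Real.exp (N * r * (t + s) + N * r * (t + s) ^ 2))) +
          4 * (Real.exp (-(-s * (N * r))) *
            (4 * Real.exp (N * r * (t + -s) + N * r * (t + -s) ^ 2))) := by gcongr
      _ ≤ _ := by linarith

/-- For small means the tilts ±s of the other case would be too large. Instead size biasing absorbs
the division by the mean: v²/(Nr) times the weight of Bin(N,r) at v equals v times the weight of
Bin(N-1,r) at v-1. -/
lemma hasPoissonBounds_deviationWeight_of_le_one {N : ℕ} {r : ℝ} (h0 : 0 < r) (h1 : r ≤ 1)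
    (hN0 : 1 ≤ N) (hN : N * r ≤ 1) : HasPoissonBounds 256 (N * r) (deviationWeight N r) := by
  obtain ⟨N, rfl⟩ : ∃ N', N = N' + 1 := ⟨N - 1, by omega⟩
  push_cast at hN ⊢
  have hNr : 0 < ((N : ℝ) + 1) * r := by positivity
  have hNr' : (N : ℝ) * r ≤ 1 := by nlinarith
  have hNr0 : 0 ≤ (N : ℝ) * r := by positivity
  have hb := fun N v => binomWeight_nonneg h0.le h1 N v
  have he2 : Real.exp 2 ≤ 8 := by
    have := Real.exp_one_lt_d9
    have h2 : Real.exp 1 ^ 2 = Real.exp 2 := by rw [← Real.exp_nat_mul]; norm_num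
    nlinarith [Real.exp_pos 1]
  have he : Real.exp (1 / 2) ≤ 2 := by
    have := Real.exp_one_lt_d9
    have h2 : Real.exp (1 / 2) ^ 2 = Real.exp 1 := by
      rw [← Real.exp_nat_mul]; norm_num
    nlinarith [Real.exp_pos (1 / 2)]
  have hsum : ∀ M : ℕ, (M : ℝ) * r ≤ 1 → ∀ t : ℝ, |t| ≤ 1 → ∀ n,
      ∑ v ∈ Finset.range n, binomWeight M r v * Real.exp (t * v) ≤ 8 := by
    intro M hM t ht n
    refine (sum_binomWeight_mul_exp_le h0.le h1 ht M n).trans (le_trans ?_ he2)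
    refine Real.exp_le_exp.2 ?_
    have hM0 : 0 ≤ (M : ℝ) * r := by positivity
    have ht1 : t ≤ 1 := (abs_le.1 ht).2
    have ht2 : t ^ 2 ≤ 1 := by rw [sq_le_one_iff_abs_le_one]; exact ht
    nlinarith
  rw [show (256 : ℝ) = 4 * 64 by norm_num]
  refine HasPoissonBounds.of_sum_le hNr.le hN
    (fun v => deviationWeight_nonneg h0.le h1 _ v) fun t ht n => ?_
  have ht' := abs_le.1 ht
  have hdev : ∀ v : ℕ, deviationWeight (N + 1) r v ≤
      (v : ℝ) ^ 2 / ((N + 1) * r) * binomWeight (N + 1) r v + binomWeight (N + 1) r v := by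
    intro v
    rw [deviationWeight, ← add_one_mul]
    refine mul_le_mul_of_nonneg_right ?_ (hb _ _)
    push_cast
    rw [div_add_one hNr.ne']
    refine div_le_div_of_nonneg_right ?_ hNr.le
    nlinarith [mul_nonneg (Nat.cast_nonneg (α := ℝ) v) hNr.le]
  have hshift : ∑ v ∈ Finset.range n,
      (v : ℝ) ^ 2 / ((N + 1) * r) * binomWeight (N + 1) r v * Real.exp (t * v) ≤ 32 := by
    refine (Finset.sum_le_sum_of_subset_of_nonneg
      (Finset.range_subset_range.2 (Nat.le_succ n)) fun v _ _ => ?_).trans ?_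
    · have := hb (N + 1) v
      positivity
    rw [Finset.sum_range_succ']
    calc _ ≤ ∑ v ∈ Finset.range n, 4 * (binomWeight N r v * Real.exp ((t + 1 / 2) * v)) := by
          simp only [Nat.cast_zero, ne_eq, OfNat.ofNat_ne_zero, not_false_eq_true, zero_pow,
            zero_div, zero_mul, add_zero]
          refine Finset.sum_le_sum fun v _ => ?_
          have h2 := succ_mul_binomWeight_succ N v r
          have h3 : ((v + 1 : ℕ) : ℝ) ^ 2 / ((N + 1) * r) * binomWeight (N + 1) r (v + 1) =
              (v + 1) * binomWeight N r v := by
            push_cast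
            rw [div_mul_eq_mul_div, div_eq_iff hNr.ne']
            linear_combination ((v : ℝ) + 1) * h2
          rw [h3]
          have h4 : (v : ℝ) + 1 ≤ 2 * Real.exp (1 / 2 * v) := by
            have := Real.add_one_le_exp (1 / 2 * (v : ℝ))
            have : (0 : ℝ) ≤ v := Nat.cast_nonneg v
            linarith
          have h5 : Real.exp (t * (v + 1 : ℕ)) ≤ 2 * Real.exp (t * v) := by
            push_cast
            rw [mul_add, mul_one, Real.exp_add, mul_comm]
            gcongr
            exact (Real.exp_le_exp.2 ht'.2).trans he
          have h6 := hb N v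
          calc _ ≤ 2 * Real.exp (1 / 2 * v) * binomWeight N r v * (2 * Real.exp (t * v)) := by
                gcongr
            _ = _ := by rw [add_mul, Real.exp_add]; ring
      _ ≤ 4 * 8 := by
          rw [← Finset.mul_sum]
          gcongr
          exact hsum N hNr' _ (abs_le.2 ⟨by linarith, by linarith⟩) n
      _ = 32 := by norm_num
  have hplain := hsum (N + 1) (by push_cast; exact hN) t (by linarith) n
  calc _ ≤ ∑ v ∈ Finset.range n,
        ((v : ℝ) ^ 2 / ((N + 1) * r) * binomWeight (N + 1) r v * Real.exp (t * v) +
          binomWeight (N + 1) r v * Real.exp (t * v)) := by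
        refine Finset.sum_le_sum fun v _ => ?_
        rw [← add_mul]
        exact mul_le_mul_of_nonneg_right (hdev v) (Real.exp_pos _).le
    _ ≤ 64 := by rw [Finset.sum_add_distrib]; linarith

lemma hasPoissonBounds_deviationWeight {N : ℕ} {r : ℝ} (h0 : 0 < r) (h1 : r ≤ 1 / 10)
    (hN0 : 1 ≤ N) : HasPoissonBounds 256 (N * r) (deviationWeight N r) := by
  rcases le_total 1 ((N : ℝ) * r) with h | h
  · exact (hasPoissonBounds_deviationWeight_of_one_le h0 h1 h).mono (by norm_num)
  · exact hasPoissonBounds_deviationWeight_of_le_one h0 (by linarith) hN0 h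

/-- Changing the mean by at most 1 changes the exponent by at most 1, since t + 2t² ≤ 1 for |t| ≤
1/2. This removes the index shifts m+1, k+1, … created by the commutators. -/
lemma HasPoissonBounds.of_mean_sub_le {L μ ν : ℝ} {P : ℕ → ℝ} (hL : 0 ≤ L)
    (h : HasPoissonBounds L μ P) (h1 : ν ≤ μ) (h2 : μ ≤ ν + 1) :
    HasPoissonBounds (8 * L) ν P := by
  have he : Real.exp 1 ≤ 8 := by linarith [Real.exp_one_lt_d9]
  have key : ∀ t : ℝ, |t| ≤ 1 / 2 → L * Real.exp (μ * t + 2 * μ * t ^ 2) ≤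
      8 * L * Real.exp (ν * t + 2 * ν * t ^ 2) := by
    intro t ht
    have ht' := abs_le.1 ht
    have h3 : Real.exp (μ * t + 2 * μ * t ^ 2) ≤ 8 * Real.exp (ν * t + 2 * ν * t ^ 2) := by
      calc _ ≤ Real.exp (1 + (ν * t + 2 * ν * t ^ 2)) := by
            refine Real.exp_le_exp.2 ?_
            nlinarith
        _ ≤ _ := by rw [Real.exp_add]; gcongr
    nlinarith
  refine ⟨h.nonneg, fun t ht n => (h.sum_le t ht n).trans (key t ht), fun t ht v => ?_⟩
  refine le_trans ?_ ((h.le t ht v).trans (key t ht))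
  have := mul_nonneg (h.nonneg v) (Real.exp_pos (t * v)).le
  gcongr

/-! ### Overlap of four weights -/

/-- Tilting each factor of `√(P₁P₂P₃P₄)` by exponentials whose rates add up to zero. -/
lemma HasPoissonBounds.sum_sqrt_mul_le {L A₁ A₂ A₃ A₄ : ℝ} {P₁ P₂ P₃ P₄ : ℕ → ℝ} (hL : 0 ≤ L)
    (h₁ : HasPoissonBounds L A₁ P₁) (h₂ : HasPoissonBounds L A₂ P₂)
    (h₃ : HasPoissonBounds L A₃ P₃) (h₄ : HasPoissonBounds L A₄ P₄) {t₁ t₂ t₃ t₄ : ℝ}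
    (ht₁ : |t₁| ≤ 1 / 2) (ht₂ : |t₂| ≤ 1 / 2) (ht₃ : |t₃| ≤ 1 / 2) (ht₄ : |t₄| ≤ 1 / 2)
    (ht : t₁ + t₂ + t₃ + t₄ = 0) (m l : ℕ) :
    (∑ u ∈ Finset.range (min m l + 1),
      Real.sqrt (P₁ (m - u) * P₂ (m - u) * P₃ (l - u) * P₄ (l - u))) *
        Real.sqrt (Real.sqrt (1 + A₂) * Real.sqrt (1 + A₄)) ≤
      L ^ 2 * Real.exp (-((t₃ + t₄) / 2 * ((l : ℝ) - m)) +
        ((A₁ * t₁ + A₂ * t₂ + A₃ * t₃ + A₄ * t₄) / 2 +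
          (A₁ * t₁ ^ 2 + A₂ * t₂ ^ 2 + A₃ * t₃ ^ 2 + A₄ * t₄ ^ 2))) := by
  set s := Finset.range (min m l + 1) with hs
  obtain ⟨E, hE⟩ : ∃ E : ℝ → ℝ → ℝ, E = fun A t => Real.exp (A * t + 2 * A * t ^ 2) := ⟨_, rfl⟩
  have hEpos : ∀ A t, 0 < E A t := fun A t => by rw [hE]; exact Real.exp_pos _
  have hsum : ∀ (P : ℕ → ℝ) (A t : ℝ) (M : ℕ), HasPoissonBounds L A P → |t| ≤ 1 / 2 →
      min m l ≤ M → ∑ u ∈ s, P (M - u) * Real.exp (t * (M - u : ℕ)) ≤ L * E A t := by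
    intro P A t M hP ht hM
    rw [hE]
    refine le_trans ?_ (hP.sum_le t ht (M + 1))
    rw [← Finset.sum_range_reflect (fun v : ℕ => P v * Real.exp (t * v)) (M + 1)]
    refine (Finset.sum_le_sum_of_subset_of_nonneg (t := Finset.range (M + 1))
      (Finset.range_subset_range.2 (by omega)) fun u _ _ =>
        mul_nonneg (hP.nonneg _) (Real.exp_pos _).le).trans_eq ?_
    exact Finset.sum_congr rfl fun u hu => by simp
  have hterm : ∀ u ∈ s, Real.sqrt (P₁ (m - u) * P₂ (m - u) * P₃ (l - u) * P₄ (l - u)) *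
      Real.sqrt (Real.sqrt (1 + A₂) * Real.sqrt (1 + A₄)) ≤
      Real.exp (-((t₃ + t₄) / 2 * ((l : ℝ) - m))) * Real.sqrt ((L * E A₂ t₂) * (L * E A₄ t₄)) *
        (Real.sqrt (P₁ (m - u) * Real.exp (t₁ * (m - u : ℕ))) *
          Real.sqrt (P₃ (l - u) * Real.exp (t₃ * (l - u : ℕ)))) := by
    intro u hu
    have hu' : u ≤ min m l := Nat.lt_succ_iff.1 (Finset.mem_range.1 hu)
    have n1 := h₁.nonneg (m - u)
    have n2 := h₂.nonneg (m - u)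
    have n3 := h₃.nonneg (l - u)
    have n4 := h₄.nonneg (l - u)
    have b2 := h₂.le t₂ ht₂ (m - u)
    have b4 := h₄.le t₄ ht₄ (l - u)
    have e2 : P₂ (m - u) * Real.exp (t₂ * (m - u : ℕ)) * Real.sqrt (1 + A₂) ≤ L * E A₂ t₂ := by
      rw [hE]; exact b2
    have e4 : P₄ (l - u) * Real.exp (t₄ * (l - u : ℕ)) * Real.sqrt (1 + A₄) ≤ L * E A₄ t₄ := by
      rw [hE]; exact b4
    set a := Real.exp (t₁ * (m - u : ℕ)) with ha
    set b := Real.exp (t₂ * (m - u : ℕ)) with hb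
    set c := Real.exp (t₃ * (l - u : ℕ)) with hc
    set d := Real.exp (t₄ * (l - u : ℕ)) with hd
    set e := Real.exp (-((t₃ + t₄) / 2 * ((l : ℝ) - m))) with he
    -- The u-dependence of the exponent is a multiple of t₁+t₂+t₃+t₄ = 0; the factor e² compensates
    -- what remains, which depends on l-m alone.
    have habcd : e ^ 2 * (a * b * c * d) = 1 := by
      rw [ha, hb, hc, hd, he, ← Real.exp_nat_mul, ← Real.exp_add, ← Real.exp_add, ← Real.exp_add,
        ← Real.exp_add, Real.exp_eq_one_iff, Nat.cast_sub (by omega), Nat.cast_sub (by omega)]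
      push_cast
      linear_combination ((m : ℝ) - u) * ht
    have he0 : 0 ≤ e := (Real.exp_pos _).le
    have ha0 : 0 ≤ a := (Real.exp_pos _).le
    have hb0 : 0 ≤ b := (Real.exp_pos _).le
    have hc0 : 0 ≤ c := (Real.exp_pos _).le
    have hd0 : 0 ≤ d := (Real.exp_pos _).le
    have hZ : 0 ≤ (L * E A₂ t₂) * (L * E A₄ t₄) := by
      have := hEpos A₂ t₂
      have := hEpos A₄ t₄
      positivity
    calc _ = Real.sqrt (P₁ (m - u) * P₂ (m - u) * P₃ (l - u) * P₄ (l - u) *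
          (Real.sqrt (1 + A₂) * Real.sqrt (1 + A₄))) := (Real.sqrt_mul (by positivity) _).symm
      _ ≤ Real.sqrt (e ^ 2 * ((L * E A₂ t₂) * (L * E A₄ t₄)) *
          (P₁ (m - u) * a * (P₃ (l - u) * c))) := by
        refine Real.sqrt_le_sqrt ?_
        calc _ = e ^ 2 * (a * b * c * d) * (P₁ (m - u) * P₂ (m - u) * P₃ (l - u) * P₄ (l - u) *
              (Real.sqrt (1 + A₂) * Real.sqrt (1 + A₄))) := by rw [habcd, one_mul]
          _ = e ^ 2 * ((P₂ (m - u) * b * Real.sqrt (1 + A₂)) *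
              (P₄ (l - u) * d * Real.sqrt (1 + A₄))) *
              (P₁ (m - u) * a * (P₃ (l - u) * c)) := by ring
          _ ≤ _ := by
            gcongr
            exact mul_nonneg hL (hEpos _ _).le
      _ = _ := by
        rw [Real.sqrt_mul (mul_nonneg (sq_nonneg e) hZ), Real.sqrt_mul (sq_nonneg e),
          Real.sqrt_sq he0, Real.sqrt_mul (mul_nonneg n1 ha0)]
  rw [Finset.sum_mul]
  refine (Finset.sum_le_sum hterm).trans ?_
  rw [← Finset.mul_sum]
  have hcs := Real.sum_sqrt_mul_sqrt_le (s := s)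
    (f := fun u => P₁ (m - u) * Real.exp (t₁ * (m - u : ℕ)))
    (g := fun u => P₃ (l - u) * Real.exp (t₃ * (l - u : ℕ)))
    (fun u => mul_nonneg (h₁.nonneg _) (Real.exp_pos _).le)
    (fun u => mul_nonneg (h₃.nonneg _) (Real.exp_pos _).le)
  have s1 := hsum P₁ A₁ t₁ m h₁ ht₁ (min_le_left _ _)
  have s3 := hsum P₃ A₃ t₃ l h₃ ht₃ (min_le_right _ _)
  have hprod : Real.sqrt ((L * E A₂ t₂) * (L * E A₄ t₄)) *
      (Real.sqrt (L * E A₁ t₁) * Real.sqrt (L * E A₃ t₃)) =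
      L ^ 2 * Real.exp ((A₁ * t₁ + A₂ * t₂ + A₃ * t₃ + A₄ * t₄) / 2 +
          (A₁ * t₁ ^ 2 + A₂ * t₂ ^ 2 + A₃ * t₃ ^ 2 + A₄ * t₄ ^ 2)) := by
    have p1 := hEpos A₁ t₁
    have p2 := hEpos A₂ t₂
    have p3 := hEpos A₃ t₃
    have p4 := hEpos A₄ t₄
    rw [← Real.sqrt_mul (by positivity), ← Real.sqrt_mul (by positivity),
      Real.sqrt_eq_iff_mul_self_eq (by positivity) (by positivity), hE]
    have : ∀ x : ℝ, L ^ 2 * Real.exp x * (L ^ 2 * Real.exp x) = L ^ 4 * Real.exp (x + x) := by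
      intro x; rw [Real.exp_add]; ring
    rw [this]
    have : ∀ x y z w : ℝ, L * Real.exp x * (L * Real.exp y) * (L * Real.exp z * (L * Real.exp w)) =
        L ^ 4 * Real.exp (x + y + z + w) := by
      intro x y z w; simp only [Real.exp_add]; ring
    rw [this]
    congr 2
    ring
  rw [Real.exp_add, mul_left_comm (L ^ 2), ← hprod, mul_assoc]
  refine mul_le_mul_of_nonneg_left ?_ (Real.exp_pos _).le
  refine mul_le_mul_of_nonneg_left ?_ (Real.sqrt_nonneg _)
  refine hcs.trans ?_
  gcongr

/-! ### Choice of the tilts and the decay profile -/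

/-- The right-hand side `gnBound` with `M ^ (-i)` replaced by a real parameter. -/
noncomputable def decayProfile (C ε c : ℝ) (k h p : ℕ) : ℝ :=
  Real.exp (-(c * (p : ℝ) ^ 2 / (1 + k * ε))
      - c * ε / (1 + k) * ((h : ℝ) - k / (1 + C)) ^ 2) / (1 + Real.sqrt (k * ε))
  + Real.exp (-(c * k * ε) - c * p)

/-- The constraints on the indices and on the parameter under which the kernel is estimated;
`e` is the offset of `k` from `m + h + p`. -/
structure KernelRange (C α : ℝ) (m h p k : ℕ) (e : ℝ) : Prop where
  C_pos : 0 < C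
  α_pos : 0 < α
  α_small : (1 + 2 * C) * α ≤ 1 / 10
  k_eq : (k : ℝ) = m + h + p + e
  abs_le : |e| ≤ 1

section Range

variable {C α e : ℝ} {m h p k : ℕ}

/-- The exponential estimate, with the rates of the tilts still free. -/
lemma KernelRange.exponent_le (H : KernelRange C α m h p k e) {s lam τ : ℝ} (hs : |s - p| ≤ 1)
    (hτ0 : 0 ≤ τ) (hτ : τ ≤ 1 / 2) {δ : ℝ} (hδ0 : 0 < δ) (hδ : δ ≤ α) :
    -(((lam + τ / 2) + (-lam + τ / 2)) / 2 * s) +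
      ((m * ((1 + C) * δ) * (lam - τ / 2) + (m + h) * (C * δ) * (-lam - τ / 2) +
        (m + p) * ((1 + C) * δ) * (lam + τ / 2) + k * (C * δ) * (-lam + τ / 2)) / 2 +
      (m * ((1 + C) * δ) * (lam - τ / 2) ^ 2 + (m + h) * (C * δ) * (-lam - τ / 2) ^ 2 +
        (m + p) * ((1 + C) * δ) * (lam + τ / 2) ^ 2 + k * (C * δ) * (-lam + τ / 2) ^ 2)) ≤
    1 - τ * p / 4 + (1 + 2 * C) * (1 + k * α) * τ ^ 2 +
      lam * ((2 * m + p) * ((1 + C) * δ) - (m + h + k) * (C * δ)) / 2 +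
      4 * (1 + 2 * C) * (1 + k * α) * lam ^ 2 := by
  obtain ⟨hC, hα, hsm, hk, he⟩ := H
  have he' := _root_.abs_le.1 he
  have hs' := _root_.abs_le.1 hs
  have hm0 : (0 : ℝ) ≤ m := Nat.cast_nonneg m
  have hh0 : (0 : ℝ) ≤ h := Nat.cast_nonneg h
  have hp0 : (0 : ℝ) ≤ p := Nat.cast_nonneg p
  have hk0 : (0 : ℝ) ≤ k := Nat.cast_nonneg k
  have hr0 : 0 ≤ (1 + C) * δ := by positivity
  have hq0 : 0 ≤ C * δ := by positivity
  have hCδ : (1 + C) * δ + C * δ ≤ 1 / 10 := by nlinarith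
  have hsq : ∀ x y : ℝ, (x + y / 2) ^ 2 ≤ 2 * x ^ 2 + y ^ 2 / 2 := fun x y => by
    nlinarith [sq_nonneg (x - y / 2)]
  have q1 : (lam - τ / 2) ^ 2 ≤ 2 * lam ^ 2 + τ ^ 2 / 2 := by
    have := hsq lam (-τ); ring_nf at this ⊢; linarith
  have q2 : (-lam - τ / 2) ^ 2 ≤ 2 * lam ^ 2 + τ ^ 2 / 2 := by
    have := hsq lam τ; ring_nf at this ⊢; linarith
  have q3 := hsq lam τ
  have q4 : (-lam + τ / 2) ^ 2 ≤ 2 * lam ^ 2 + τ ^ 2 / 2 := by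
    have := hsq (-lam) τ; ring_nf at this ⊢; linarith
  have hquad : m * ((1 + C) * δ) * (lam - τ / 2) ^ 2 + (m + h) * (C * δ) * (-lam - τ / 2) ^ 2 +
      (m + p) * ((1 + C) * δ) * (lam + τ / 2) ^ 2 + k * (C * δ) * (-lam + τ / 2) ^ 2 ≤
      (2 * ((1 + 2 * C) * (1 + k * α))) * (2 * lam ^ 2 + τ ^ 2 / 2) := by
    calc _ ≤ m * ((1 + C) * δ) * (2 * lam ^ 2 + τ ^ 2 / 2) +
          (m + h) * (C * δ) * (2 * lam ^ 2 + τ ^ 2 / 2) +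
          (m + p) * ((1 + C) * δ) * (2 * lam ^ 2 + τ ^ 2 / 2) +
          k * (C * δ) * (2 * lam ^ 2 + τ ^ 2 / 2) := by gcongr
      _ = (m * ((1 + C) * δ) + (m + h) * (C * δ) + (m + p) * ((1 + C) * δ) + k * (C * δ)) *
          (2 * lam ^ 2 + τ ^ 2 / 2) := by ring
      _ ≤ _ := by
        refine mul_le_mul_of_nonneg_right ?_ (by positivity)
        calc _ ≤ ((k : ℝ) + 1) * ((1 + C) * δ) + (k + 1) * (C * δ) + (k + 1) * ((1 + C) * δ) +
              (k + 1) * (C * δ) :=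
              add_le_add (add_le_add (add_le_add
                (mul_le_mul_of_nonneg_right (by linarith) hr0)
                (mul_le_mul_of_nonneg_right (by linarith) hq0))
                (mul_le_mul_of_nonneg_right (by linarith) hr0))
                (mul_le_mul_of_nonneg_right (by linarith) hq0)
          _ = 2 * ((1 + 2 * C) * ((k + 1) * δ)) := by ring
          _ ≤ 2 * ((1 + 2 * C) * (1 + k * α)) := by
            have : ((k : ℝ) + 1) * δ ≤ 1 + k * α := by
              have : (k : ℝ) * δ ≤ k * α := by gcongr
              nlinarith
            gcongr
  -- The means of the first and third laws differ by pr, those of the second and fourth by (p+e)q.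
  -- As r+q ≤ 1/10, this drift consumes only a small part of the decay τs/2.
  have hlin : τ * (p * ((1 + C) * δ) + (p + e) * (C * δ)) ≤ τ * (p / 10 + 1) := by
    refine mul_le_mul_of_nonneg_left ?_ hτ0
    have : e * (C * δ) ≤ 1 * (C * δ) := mul_le_mul_of_nonneg_right he'.2 hq0
    nlinarith
  have hτs : τ * (p - 1) ≤ τ * s := mul_le_mul_of_nonneg_left (by linarith) hτ0
  have hkk : (k : ℝ) * (C * δ) * τ = (m + h + p + e) * (C * δ) * τ := by rw [← hk]
  have hτp : 0 ≤ τ * p := by positivity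
  nlinarith

end Range

lemma small_parameter_bounds {C α δ : ℝ} (hC : 0 < C) (hα : 0 < α)
    (hsm : (1 + 2 * C) * α ≤ 1 / 10) (hδ : δ * (1 + C * α) = α) :
    α ≤ 1 / 10 ∧ C * α ≤ 1 / 20 ∧ 0 < δ ∧ δ ≤ α ∧ α ≤ 2 * δ ∧ (2 + C) * δ ≤ 1 := by
  have hCα : 0 < C * α := by positivity
  have h1 : α ≤ 1 / 10 := by linarith
  have h2 : C * α ≤ 1 / 20 := by linarith
  have h3 : 0 < δ := pos_of_mul_pos_left (hδ.symm ▸ hα) (by linarith)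
  have h4 : δ ≤ α := by nlinarith
  have h5 : δ * (C * α) ≤ δ * (1 / 20) := mul_le_mul_of_nonneg_left h2 h3.le
  have h6 : C * δ ≤ C * α := mul_le_mul_of_nonneg_left h4 hC.le
  exact ⟨h1, h2, h3, h4, by linarith, by linarith⟩

section Range

variable {C α e : ℝ} {m h p k : ℕ}

/-- The parameter x is the decay rate in p up to a constant. It is capped by 1, as the tilts must
stay bounded, and by p/(1+kα), beyond which the term quadratic in τ would win. -/
lemma KernelRange.sum_mul_le (H : KernelRange C α m h p k e) {m' l' : ℕ}
    (hs : |(l' : ℝ) - m' - p| ≤ 1) {δ : ℝ} (hδ0 : 0 < δ) (hδ : δ ≤ α) {L : ℝ} (hL : 0 ≤ L)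
    {P₁ P₂ P₃ P₄ : ℕ → ℝ}
    (h₁ : HasPoissonBounds L (m * ((1 + C) * δ)) P₁)
    (h₂ : HasPoissonBounds L ((m + h) * (C * δ)) P₂)
    (h₃ : HasPoissonBounds L ((m + p) * ((1 + C) * δ)) P₃)
    (h₄ : HasPoissonBounds L (k * (C * δ)) P₄) {x : ℝ} (hx0 : 0 ≤ x) (hx1 : x ≤ 1)
    (hxp : (1 + k * α) * x ≤ p) :
    (∑ u ∈ Finset.range (min m' l' + 1),
      Real.sqrt (P₁ (m' - u) * P₂ (m' - u) * P₃ (l' - u) * P₄ (l' - u))) *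
        Real.sqrt (Real.sqrt (1 + (m + h) * (C * δ)) * Real.sqrt (1 + k * (C * δ))) ≤
      L ^ 2 * Real.exp (1 - (x * p +
        ((2 * m + p) * ((1 + C) * δ) - (m + h + k) * (C * δ)) ^ 2 / (1 + k * α)) /
          (64 * (1 + 2 * C))) := by
  have hC := H.C_pos
  have hα := H.α_pos
  have hsm := H.α_small
  have hk := H.k_eq
  have he' := _root_.abs_le.1 H.abs_le
  have hm0 : (0 : ℝ) ≤ m := Nat.cast_nonneg m
  have hh0 : (0 : ℝ) ≤ h := Nat.cast_nonneg h
  have hp0 : (0 : ℝ) ≤ p := Nat.cast_nonneg p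
  have hk0 : (0 : ℝ) ≤ k := Nat.cast_nonneg k
  obtain ⟨B, hB⟩ : ∃ B, B = 1 + 2 * C := ⟨_, rfl⟩
  obtain ⟨Q, hQ⟩ : ∃ Q, Q = 1 + k * α := ⟨_, rfl⟩
  obtain ⟨Δ, hΔ⟩ : ∃ Δ, Δ = (2 * m + p) * ((1 + C) * δ) - (m + h + k) * (C * δ) := ⟨_, rfl⟩
  have hB1 : 1 ≤ B := by linarith
  have hQ1 : 1 ≤ Q := by have := mul_nonneg hk0 hα.le; linarith
  have hkδ : ((k : ℝ) + 1) * δ ≤ Q := by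
    have : (k : ℝ) * δ ≤ k * α := by gcongr
    nlinarith
  have hΔQ : |Δ| ≤ 2 * B * Q := by
    have hr0 : 0 ≤ (1 + C) * δ := by positivity
    have hq0 : 0 ≤ C * δ := by positivity
    have n1 : (2 * m + p) * ((1 + C) * δ) ≤ 2 * (k + 1) * ((1 + C) * δ) :=
      mul_le_mul_of_nonneg_right (by linarith) hr0
    have n2 : (m + h + k) * (C * δ) ≤ 2 * (k + 1) * (C * δ) :=
      mul_le_mul_of_nonneg_right (by linarith) hq0
    have n3 : 0 ≤ (2 * m + p) * ((1 + C) * δ) := by positivity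
    have n4 : 0 ≤ (m + h + k) * (C * δ) := by positivity
    have n5 : 2 * (k + 1) * ((1 + C) * δ) + 2 * (k + 1) * (C * δ) ≤ 2 * B * Q := by
      calc _ = 2 * B * ((k + 1) * δ) := by rw [hB]; ring
        _ ≤ _ := by gcongr
    rw [_root_.abs_le, hΔ]
    constructor <;> linarith
  -- This λ minimizes λΔ/2 + 4BQλ², with minimum -Δ²/(64BQ). The choice of τ lets its quadratic cost
  -- BQτ² use at most half of the gain τp/4.
  set lam := -(Δ / (16 * B * Q)) with hlam
  set τ := x / (8 * B) with hτ
  have hτ0 : 0 ≤ τ := by positivity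
  have hτ1 : τ ≤ 1 / 8 := by
    rw [hτ, div_le_iff₀ (by positivity)]
    linarith
  have hlam1 : |lam| ≤ 1 / 8 := by
    rw [hlam, abs_neg, abs_div, abs_of_pos (show 0 < 16 * B * Q by positivity),
      div_le_iff₀ (by positivity)]
    linarith
  have hl := _root_.abs_le.1 hlam1
  have main := h₁.sum_sqrt_mul_le hL h₂ h₃ h₄ (t₁ := lam - τ / 2) (t₂ := -lam - τ / 2)
    (t₃ := lam + τ / 2) (t₄ := -lam + τ / 2)
    (_root_.abs_le.2 ⟨by linarith, by linarith⟩) (_root_.abs_le.2 ⟨by linarith, by linarith⟩)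
    (_root_.abs_le.2 ⟨by linarith, by linarith⟩) (_root_.abs_le.2 ⟨by linarith, by linarith⟩)
    (by ring) m' l'
  refine main.trans (mul_le_mul_of_nonneg_left (Real.exp_le_exp.2 ?_) (sq_nonneg L))
  refine (H.exponent_le hs hτ0 (by linarith) hδ0 hδ).trans ?_
  rw [← hΔ, ← hQ, ← hB]
  have e1 : B * Q * τ ^ 2 ≤ τ * p / 8 := by
    calc B * Q * τ ^ 2 = τ / 8 * (Q * x) := by rw [hτ]; field_simp
      _ ≤ τ / 8 * p := by rw [hQ]; gcongr
      _ = _ := by ring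
  have e2 : lam * Δ / 2 + 4 * B * Q * lam ^ 2 = -(Δ ^ 2 / Q / (64 * B)) := by
    rw [hlam]; field_simp; ring
  have e3 : τ * p / 8 = x * p / (64 * B) := by rw [hτ]; field_simp; ring
  rw [add_div]
  linarith

/-- Away from the negligible region, the mismatch of the means controls both Gaussian factors. -/
lemma KernelRange.gaussian_le (H : KernelRange C α m h p k e) {δ : ℝ} (hδ : δ * (1 + C * α) = α) :
    (p : ℝ) ^ 2 / (1 + k * α) / 12 + α / (1 + k) * ((h : ℝ) - k / (1 + C)) ^ 2 / 12 ≤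
      1 + ((p : ℝ) ^ 2 / (1 + k * α) +
        ((2 * m + p) * ((1 + C) * δ) - (m + h + k) * (C * δ)) ^ 2 / (1 + k * α)) := by
  obtain ⟨hC, hα, hsm, hk, he⟩ := H
  have hm0 : (0 : ℝ) ≤ m := Nat.cast_nonneg m
  have hh0 : (0 : ℝ) ≤ h := Nat.cast_nonneg h
  have hp0 : (0 : ℝ) ≤ p := Nat.cast_nonneg p
  have hk0 : (0 : ℝ) ≤ k := Nat.cast_nonneg k
  have he' := _root_.abs_le.1 he
  have hCα : 0 < C * α := by positivity
  have hkα : 0 ≤ k * α := by positivity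
  obtain ⟨hα1, hCα1, hδ0, hδα', hδα, hδC⟩ := small_parameter_bounds hC hα hsm hδ
  obtain ⟨X, hX⟩ : ∃ X, X = (h : ℝ) - k / (1 + C) := ⟨_, rfl⟩
  obtain ⟨Δ, hΔ⟩ : ∃ Δ, Δ = (2 * m + p) * ((1 + C) * δ) - (m + h + k) * (C * δ) := ⟨_, rfl⟩
  rw [← hX, ← hΔ]
  set Q := 1 + k * α with hQ
  have hQ1 : 1 ≤ Q := by linarith
  have hp2 : 0 ≤ (p : ℝ) ^ 2 / Q := by positivity
  have hΔ2 : 0 ≤ Δ ^ 2 / Q := by positivity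
  -- For kα ≤ 1 the Gaussian in h - k/(1+C) has an exponent bounded by 8 and needs no argument.
  -- Otherwise Δ, p and e determine (h - k/(1+C))δ through a linear identity.
  rcases le_total (k * α) 1 with hc | hc
  · have hXle : X ^ 2 ≤ (2 * (k + 1)) ^ 2 := by
      have h1 : (k : ℝ) / (1 + C) ≤ k := div_le_self hk0 (by linarith)
      have h2 : 0 ≤ (k : ℝ) / (1 + C) := by positivity
      refine sq_le_sq' ?_ ?_ <;> rw [hX] <;> linarith
    have : α / (1 + k) * X ^ 2 ≤ 8 := by
      calc _ ≤ α / (1 + k) * (2 * (k + 1)) ^ 2 := by gcongr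
        _ = 4 * (k * α + α) := by field_simp; ring
        _ ≤ 8 := by linarith
    linarith
  · have hXΔ : 2 * ((1 + C) * X) * δ = -Δ - δ * p - e * (2 + C) * δ := by
      have : (1 + C) * X = (1 + C) * h - k := by rw [hX]; field_simp
      rw [this, hΔ, hk]
      ring
    have hXsq : 4 * (X ^ 2 * δ ^ 2) ≤ 3 * (Δ ^ 2 + p ^ 2 + 1) := by
      have h1 : (e * (2 + C) * δ) ^ 2 ≤ 1 := by
        rw [sq_le_one_iff_abs_le_one, abs_mul, abs_mul, abs_of_pos hδ0,
          abs_of_pos (show 0 < 2 + C by linarith)]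
        rw [mul_assoc]
        exact mul_le_one₀ he (by positivity) hδC
      have h2 : (δ * p) ^ 2 ≤ p ^ 2 := by
        rw [mul_pow]
        have : δ ^ 2 ≤ 1 := pow_le_one₀ hδ0.le (by linarith)
        exact mul_le_of_le_one_left (sq_nonneg _) this
      have h3 : 4 * (X ^ 2 * δ ^ 2) ≤ (2 * ((1 + C) * X) * δ) ^ 2 := by
        calc 4 * (X ^ 2 * δ ^ 2) = 4 * (1 * (X ^ 2 * δ ^ 2)) := by ring
          _ ≤ 4 * ((1 + C) ^ 2 * (X ^ 2 * δ ^ 2)) := by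
            have : 1 ≤ (1 + C) ^ 2 := one_le_pow₀ (by linarith)
            gcongr
          _ = _ := by ring
      have h4' : ∀ x y z : ℝ, (-x - y - z) ^ 2 ≤ 3 * (x ^ 2 + y ^ 2 + z ^ 2) := fun x y z => by
        nlinarith [sq_nonneg (x - y), sq_nonneg (x - z), sq_nonneg (y - z)]
      have h4 := h4' Δ (δ * p) (e * (2 + C) * δ)
      rw [hXΔ] at h3
      linarith
    have hrate : α / (1 + k) ≤ 8 * δ ^ 2 / Q := by
      rw [div_le_div_iff₀ (by linarith) (by linarith), hQ]
      have h5 : α ^ 2 ≤ (2 * δ) ^ 2 := pow_le_pow_left₀ hα.le hδα 2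
      have h6 : α ^ 2 * (1 + k) ≤ (2 * δ) ^ 2 * (1 + k) :=
        mul_le_mul_of_nonneg_right h5 (by linarith)
      have h7 : α * 1 ≤ α * (k * α) := mul_le_mul_of_nonneg_left hc hα.le
      have h8 : 0 ≤ α ^ 2 := sq_nonneg α
      linarith
    have : α / (1 + k) * X ^ 2 ≤ 6 * (Δ ^ 2 / Q + p ^ 2 / Q + 1) := by
      calc _ ≤ 8 * δ ^ 2 / Q * X ^ 2 := by gcongr
        _ = 2 / Q * (4 * (X ^ 2 * δ ^ 2)) := by ring
        _ ≤ 2 / Q * (3 * (Δ ^ 2 + p ^ 2 + 1)) := by gcongr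
        _ = 6 * (Δ ^ 2 / Q + p ^ 2 / Q + 1 / Q) := by ring
        _ ≤ _ := by
          have : 1 / Q ≤ 1 := (div_le_one (by linarith)).2 hQ1
          linarith
    linarith

/-- When p ≤ 1+kα, the index m+h = k-p-e is at least k/2-2, so both pointwise gains are governed by
kα. The constant b degenerates with C, hence as Ω tends to 1. -/
lemma KernelRange.sqrt_le (H : KernelRange C α m h p k e) {δ : ℝ} (hδ : δ * (1 + C * α) = α)
    (hp : (p : ℝ) ≤ 1 + k * α) {b : ℝ} (hb0 : 0 ≤ b) (hb : b ≤ 1 / 2) (hbC : b ≤ C / 4) :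
    b * (1 + Real.sqrt (k * α)) ≤
      2 * Real.sqrt (Real.sqrt (1 + (m + h) * (C * δ)) * Real.sqrt (1 + k * (C * δ))) := by
  obtain ⟨hC, hα, hsm, hk, he⟩ := H
  have hk0 : (0 : ℝ) ≤ k := Nat.cast_nonneg k
  have he' := _root_.abs_le.1 he
  have hCα : 0 < C * α := by positivity
  have hkα : 0 ≤ k * α := by positivity
  obtain ⟨hα1, hCα1, hδ0, hδα', hδα, hδC⟩ := small_parameter_bounds hC hα hsm hδ
  have hCkα : b * (k * α) ≤ C / 4 * (k * α) := by gcongr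
  have h4 : b * (1 + k * α) ≤ 1 + k * (C * δ) := by nlinarith [mul_nonneg hC.le hk0]
  have h2 : b * (1 + k * α) ≤ 1 + (m + h) * (C * δ) := by
    have : (k : ℝ) / 2 - 2 ≤ m + h := by nlinarith
    have h5 : ((k : ℝ) / 2 - 2) * (C * δ) ≤ (m + h) * (C * δ) :=
      mul_le_mul_of_nonneg_right this (by nlinarith)
    nlinarith [mul_nonneg hC.le hk0]
  have h6 : b * (1 + k * α) ≤
      Real.sqrt (1 + (m + h) * (C * δ)) * Real.sqrt (1 + k * (C * δ)) := by
    have hn : 0 ≤ b * (1 + k * α) := by positivity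
    calc _ = Real.sqrt (b * (1 + k * α)) * Real.sqrt (b * (1 + k * α)) :=
          (Real.mul_self_sqrt hn).symm
      _ ≤ _ := by gcongr
  have hsq : (b * (1 + Real.sqrt (k * α)) / 2) ^ 2 ≤ b * (1 + k * α) := by
    have hq := Real.sq_sqrt hkα
    have h7 : (1 + Real.sqrt (k * α)) ^ 2 ≤ 2 * (1 + k * α) := by
      nlinarith [sq_nonneg (1 - Real.sqrt (k * α))]
    calc _ = b * (b / 4 * (1 + Real.sqrt (k * α)) ^ 2) := by ring
      _ ≤ b * (1 / 2 * (2 * (1 + k * α))) := by gcongr <;> linarith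
      _ = _ := by ring
  have := Real.le_sqrt_of_sq_le (hsq.trans h6)
  linarith

/-- The uniform bound on a sum of square roots of four weights with Poisson-type bounds. -/
lemma KernelRange.sum_le (H : KernelRange C α m h p k e) {m' l' : ℕ}
    (hs : |(l' : ℝ) - m' - p| ≤ 1) {δ : ℝ} (hδ : δ * (1 + C * α) = α) {L : ℝ} (hL : 0 ≤ L)
    {P₁ P₂ P₃ P₄ : ℕ → ℝ}
    (h₁ : HasPoissonBounds L (m * ((1 + C) * δ)) P₁)
    (h₂ : HasPoissonBounds L ((m + h) * (C * δ)) P₂)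
    (h₃ : HasPoissonBounds L ((m + p) * ((1 + C) * δ)) P₃)
    (h₄ : HasPoissonBounds L (k * (C * δ)) P₄) {b c : ℝ} (hb0 : 0 < b) (hb : b ≤ 1 / 2)
    (hbC : b ≤ C / 4) (hc : c = 1 / (768 * (1 + 2 * C))) :
    ∑ u ∈ Finset.range (min m' l' + 1),
      Real.sqrt (P₁ (m' - u) * P₂ (m' - u) * P₃ (l' - u) * P₄ (l' - u)) ≤
        16 * L ^ 2 / b * decayProfile C α c k h p := by
  have hC := H.C_pos
  have hα := H.α_pos
  have hk0 : (0 : ℝ) ≤ k := Nat.cast_nonneg k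
  have hp0 : (0 : ℝ) ≤ p := Nat.cast_nonneg p
  have hkα : 0 ≤ k * α := by positivity
  have hCα : 0 < C * α := by positivity
  obtain ⟨-, -, hδ0, hδα, -, -⟩ := small_parameter_bounds hC hα H.α_small hδ
  have hc0 : 0 < c := by rw [hc]; positivity
  -- 768 = 64·12: the 64 comes from the optimization of the tilts, the 12 from
  -- `KernelRange.gaussian_le`.
  have hκ : 1 / (64 * (1 + 2 * C)) = 12 * c := by rw [hc]; field_simp; norm_num
  have hc1 : 12 * c ≤ 1 := by
    rw [← hκ, div_le_one (by positivity)]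
    linarith
  have he1 : Real.exp 1 ≤ 2.7182818286 := Real.exp_one_lt_d9.le
  have he2 : Real.exp 2 ≤ 8 := by
    have h2 : Real.exp 1 ^ 2 = Real.exp 2 := by rw [← Real.exp_nat_mul]; norm_num
    nlinarith [Real.exp_pos 1]
  have key := fun x hx0 hx1 hxp => H.sum_mul_le hs hδ0 hδα hL h₁ h₂ h₃ h₄ (x := x) hx0 hx1 hxp
  set S := ∑ u ∈ Finset.range (min m' l' + 1),
      Real.sqrt (P₁ (m' - u) * P₂ (m' - u) * P₃ (l' - u) * P₄ (l' - u)) with hS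
  have hS0 : 0 ≤ S := Finset.sum_nonneg fun _ _ => Real.sqrt_nonneg _
  set W := Real.sqrt (Real.sqrt (1 + (m + h) * (C * δ)) * Real.sqrt (1 + k * (C * δ))) with hW
  have hfirst : 0 ≤ Real.exp (-(c * (p : ℝ) ^ 2 / (1 + k * α))
      - c * α / (1 + k) * ((h : ℝ) - k / (1 + C)) ^ 2) / (1 + Real.sqrt (k * α)) := by positivity
  have hsecond : 0 ≤ Real.exp (-(c * k * α) - c * p) := (Real.exp_pos _).le
  rcases le_total (p : ℝ) (1 + k * α) with hp | hp
  · have hW2 := H.sqrt_le hδ hp hb0.le hb hbC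
    have hG := H.gaussian_le hδ
    have hk1 := key (p / (1 + k * α)) (by positivity) ((div_le_one (by linarith)).2 hp)
      (by rw [mul_div_cancel₀ _ (by linarith)])
    have hexp : Real.exp (1 - (p / (1 + k * α) * p +
        ((2 * m + p) * ((1 + C) * δ) - (m + h + k) * (C * δ)) ^ 2 / (1 + k * α)) /
          (64 * (1 + 2 * C))) ≤ 8 * Real.exp (-(c * (p : ℝ) ^ 2 / (1 + k * α))
            - c * α / (1 + k) * ((h : ℝ) - k / (1 + C)) ^ 2) := by
      calc _ ≤ Real.exp (2 + (-(c * (p : ℝ) ^ 2 / (1 + k * α))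
            - c * α / (1 + k) * ((h : ℝ) - k / (1 + C)) ^ 2)) := by
            refine Real.exp_le_exp.2 ?_
            rw [div_eq_mul_one_div _ (64 * (1 + 2 * C)), hκ]
            have := mul_le_mul_of_nonneg_left hG (show 0 ≤ 12 * c by positivity)
            ring_nf at this ⊢
            linarith
        _ ≤ _ := by rw [Real.exp_add]; gcongr
    set G := Real.exp (-(c * (p : ℝ) ^ 2 / (1 + k * α))
            - c * α / (1 + k) * ((h : ℝ) - k / (1 + C)) ^ 2) with hGdef
    have h1 : S * (b * (1 + Real.sqrt (k * α))) ≤ 16 * L ^ 2 * G := by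
      calc _ ≤ S * (2 * W) := by gcongr
        _ = 2 * (S * W) := by ring
        _ ≤ 2 * (L ^ 2 * (8 * G)) := by
          exact mul_le_mul_of_nonneg_left (hk1.trans (by gcongr)) zero_le_two
        _ = _ := by ring
    have h2 : S ≤ 16 * L ^ 2 / b * (G / (1 + Real.sqrt (k * α))) := by
      rw [div_mul_div_comm, le_div_iff₀ (by positivity)]
      exact h1
    refine h2.trans ?_
    rw [decayProfile]
    gcongr
    linarith
  · have hW1 : 1 ≤ W := by
      rw [hW, Real.one_le_sqrt]
      refine one_le_mul_of_one_le_of_one_le ?_ ?_ <;> rw [Real.one_le_sqrt]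
      · have : (0 : ℝ) ≤ (m + h) * (C * δ) := by positivity
        linarith
      · have : (0 : ℝ) ≤ k * (C * δ) := by positivity
        linarith
    -- With p ≥ 1+kα the cap x = 1 is admissible. Decay at rate 12c in p pays for both c·p and c·kα,
    -- and the Δ-term is dropped.
    have hk1 := key 1 zero_le_one le_rfl (by linarith)
    have hexp : Real.exp (1 - (1 * p +
        ((2 * m + p) * ((1 + C) * δ) - (m + h + k) * (C * δ)) ^ 2 / (1 + k * α)) /
          (64 * (1 + 2 * C))) ≤ 8 * Real.exp (-(c * k * α) - c * p) := by
      calc _ ≤ Real.exp (2 + (-(c * k * α) - c * p)) := by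
            refine Real.exp_le_exp.2 ?_
            rw [div_eq_mul_one_div _ (64 * (1 + 2 * C)), hκ]
            have h3 : 0 ≤ ((2 * m + p) * ((1 + C) * δ) - (m + h + k) * (C * δ)) ^ 2 /
              (1 + k * α) * (12 * c) := by positivity
            have h4 : c * (k * α) ≤ c * p := by gcongr; linarith
            have h5 : 0 ≤ c * p := by positivity
            linarith
        _ ≤ _ := by rw [Real.exp_add]; gcongr
    have hb2 : 2 ≤ 1 / b := by rw [le_div_iff₀ hb0]; linarith
    calc S ≤ S * W := le_mul_of_one_le_right hS0 hW1
      _ ≤ L ^ 2 * (8 * Real.exp (-(c * k * α) - c * p)) := hk1.trans (by gcongr)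
      _ = 8 * L ^ 2 * 1 * Real.exp (-(c * k * α) - c * p) := by ring
      _ ≤ 8 * L ^ 2 * (2 * (1 / b)) * Real.exp (-(c * k * α) - c * p) := by gcongr; linarith
      _ = 16 * L ^ 2 / b * Real.exp (-(c * k * α) - c * p) := by ring
      _ ≤ _ := by
        rw [decayProfile]
        gcongr
        linarith

end Range

/-! ### Representation of Γ by binomial weights -/

/-- The sum of square roots of products of four binomial weights which represents `gnGamma`. -/
noncomputable def binomialKernel (r q : ℝ) (m n k l : ℕ) : ℝ :=
  ∑ u ∈ Finset.range (min m l + 1), Real.sqrt (binomWeight m r (m - u) *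
    binomWeight n q (m - u) * binomWeight l r (l - u) * binomWeight k q (l - u))

lemma gnC_pos {Ω : ℝ} (h0 : 0 < Ω) (h1 : Ω < 1) : 0 < gnC Ω := by
  have : 0 < 1 - Ω := by linarith
  unfold gnC
  positivity

/-- Writing m = a+u, n = a+g, k = b+g, l = b+u removes all truncated subtractions, and the
factorials regroup into the four binomial coefficients at a, a, b, b. -/
lemma gnA_sq (a b g u : ℕ) : gnA (a + u) (a + g) (b + g) (b + u) u ^ 2 =
    (a + u).choose a * (a + g).choose a * (b + u).choose b * (b + g).choose b := by
  have hA : gnA (a + u) (a + g) (b + g) (b + u) u =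
      Real.sqrt (((a + u).factorial : ℝ) * (a + g).factorial * (b + g).factorial *
        (b + u).factorial) /
      ((a.factorial : ℝ) * b.factorial * g.factorial * u.factorial) := by
    rw [gnA, show a + u - u = a by omega, show b + u - u = b by omega,
      show a + g + u - (a + u) = g by omega]
  rw [hA, div_pow, Real.sq_sqrt (by positivity), Nat.cast_add_choose, Nat.cast_add_choose,
    Nat.cast_add_choose, Nat.cast_add_choose]
  field_simp

lemma gnA_nonneg (m n k l u : ℕ) : 0 ≤ gnA m n k l u := by
  unfold gnA
  positivity

lemma kernel_power_identity (α : ℝ) {x T : ℝ} (hx : x ≠ 0) (hT : T ≠ 0) (a b g u : ℕ) :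
    (x / T) ^ (a + u + (b + g)) * (x ^ u / x ^ g) * (α / x) ^ (a + b) =
      (α / T) ^ (a + b) * (1 / T) ^ (u + g) * (x ^ 2) ^ u := by
  simp only [div_pow, pow_add, one_pow]
  field_simp
  ring

/-- Both sides are nonnegative, so squares are compared: factorials by `gnA_sq`, powers of √(1-α) by
`kernel_power_identity`, and the remaining constant by (C(1+Ω)/(1-Ω))² = C(1+C). -/
lemma gnGamma_term_eq {Ω α : ℝ} (hΩ0 : 0 < Ω) (hΩ1 : Ω < 1) (hα0 : 0 < α) (hα1 : α < 1)
    {δ : ℝ} (hδ : δ * (1 + gnC Ω * α) = α) (a b g u : ℕ) :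
    (Real.sqrt (1 - α) / (1 + gnC Ω * α)) ^ (a + u + (b + g)) *
      (1 - α) ^ (-(((a + g : ℕ) : ℝ) - ((a + u : ℕ) : ℝ)) / 2) *
      (gnA (a + u) (a + g) (b + g) (b + u) u *
        (gnC Ω * α * (1 + Ω) / (Real.sqrt (1 - α) * (1 - Ω))) ^ (a + u + (b + u) - 2 * u)) =
    Real.sqrt (binomWeight (a + u) ((1 + gnC Ω) * δ) a * binomWeight (a + g) (gnC Ω * δ) a *
      binomWeight (b + u) ((1 + gnC Ω) * δ) b * binomWeight (b + g) (gnC Ω * δ) b) := by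
  have hC := gnC_pos hΩ0 hΩ1
  have hx : 0 < Real.sqrt (1 - α) := Real.sqrt_pos.2 (by linarith)
  have hxsq : Real.sqrt (1 - α) ^ 2 = 1 - α := Real.sq_sqrt (by linarith)
  have hΩ2 : 0 < 1 - Ω := by linarith
  have hT : 0 < 1 + gnC Ω * α := by positivity
  have hδ' : δ = α / (1 + gnC Ω * α) := by rw [eq_div_iff hT.ne', hδ]
  have hrpow : (1 - α) ^ (-(((a + g : ℕ) : ℝ) - ((a + u : ℕ) : ℝ)) / 2) =
      Real.sqrt (1 - α) ^ u / Real.sqrt (1 - α) ^ g := by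
    rw [Real.sqrt_eq_rpow, ← Real.rpow_mul_natCast (by linarith),
      ← Real.rpow_mul_natCast (by linarith), ← Real.rpow_sub (by linarith)]
    congr 1
    push_cast
    ring
  have hD : (gnC Ω * (1 + Ω) / (1 - Ω)) ^ 2 = gnC Ω * (1 + gnC Ω) := by
    rw [gnC]
    field_simp
    ring
  have hr : 1 - (1 + gnC Ω) * δ = (1 - α) / (1 + gnC Ω * α) := by
    rw [hδ']
    field_simp
    ring
  have hq : 1 - gnC Ω * δ = 1 / (1 + gnC Ω * α) := by
    rw [hδ']
    field_simp
    ring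
  have hnn : 0 ≤ Real.sqrt (1 - α) / (1 + gnC Ω * α) := by positivity
  have hnn2 : 0 ≤ gnC Ω * α * (1 + Ω) / (Real.sqrt (1 - α) * (1 - Ω)) := by positivity
  have hA0 := gnA_nonneg (a + u) (a + g) (b + g) (b + u) u
  rw [hrpow, eq_comm]
  refine (Real.sqrt_eq_iff_mul_self_eq ?_ (by positivity)).2 ?_
  · have h1 : 0 ≤ 1 - (1 + gnC Ω) * δ := by rw [hr]; exact div_nonneg (by linarith) hT.le
    have h2 : 0 ≤ 1 - gnC Ω * δ := by rw [hq]; positivity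
    have h3 : 0 ≤ δ := by rw [hδ']; positivity
    have n1 := fun N v => binomWeight_nonneg (r := (1 + gnC Ω) * δ) (by positivity)
      (by linarith) N v
    have n2 := fun N v => binomWeight_nonneg (r := gnC Ω * δ) (by positivity) (by linarith) N v
    exact mul_nonneg (mul_nonneg (mul_nonneg (n1 _ _) (n2 _ _)) (n1 _ _)) (n2 _ _)
  have hsplit : gnC Ω * α * (1 + Ω) / (Real.sqrt (1 - α) * (1 - Ω)) =
      gnC Ω * (1 + Ω) / (1 - Ω) * (α / Real.sqrt (1 - α)) := by field_simp
  simp only [binomWeight]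
  rw [show a + u + (b + u) - 2 * u = a + b by omega, show a + u - a = u by omega,
    show a + g - a = g by omega, show b + u - b = u by omega, show b + g - b = g by omega,
    hr, hq, hsplit]
  have hpow := kernel_power_identity α hx.ne' hT.ne' a b g u
  rw [← hδ', hxsq] at hpow
  have hchoose := gnA_sq a b g u
  generalize gnA (a + u) (a + g) (b + g) (b + u) u = A at *
  generalize gnC Ω * (1 + Ω) / (1 - Ω) = E at *
  symm
  calc _ = A ^ 2 * (E ^ 2) ^ (a + b) *
        ((Real.sqrt (1 - α) / (1 + gnC Ω * α)) ^ (a + u + (b + g)) *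
          (Real.sqrt (1 - α) ^ u / Real.sqrt (1 - α) ^ g) *
          (α / Real.sqrt (1 - α)) ^ (a + b)) ^ 2 := by ring
    _ = _ := by
      rw [hchoose, hD, hpow]
      generalize 1 + gnC Ω * α = T
      generalize 1 + gnC Ω = C'
      generalize 1 - α = y
      ring

lemma gnGamma_eq_binomialKernel {Ω α : ℝ} (hΩ0 : 0 < Ω) (hΩ1 : Ω < 1) (hα0 : 0 < α)
    (hα1 : α < 1) {δ : ℝ} (hδ : δ * (1 + gnC Ω * α) = α) {m n k l : ℕ} (h : m + k = n + l) :
    gnGamma Ω α m n k l = binomialKernel ((1 + gnC Ω) * δ) (gnC Ω * δ) m n k l := by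
  rw [gnGamma, if_pos h, Finset.mul_sum, binomialKernel]
  refine Eq.trans ?_ (Finset.sum_subset (s₁ := Finset.Icc (m - n) (min m l)) ?_ ?_)
  · refine Finset.sum_congr rfl fun u hu => ?_
    obtain ⟨hu1, hu2⟩ := Finset.mem_Icc.1 hu
    obtain ⟨a, rfl⟩ : ∃ a, m = a + u := ⟨m - u, by omega⟩
    obtain ⟨b, rfl⟩ : ∃ b, l = b + u := ⟨l - u, by omega⟩
    obtain ⟨g, rfl⟩ : ∃ g, n = a + g := ⟨n - a, by omega⟩
    obtain rfl : k = b + g := by omega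
    rw [gnGamma_term_eq hΩ0 hΩ1 hα0 hα1 hδ, Nat.add_sub_cancel, Nat.add_sub_cancel]
  · intro u hu
    exact Finset.mem_range.2 (Nat.lt_succ_of_le (Finset.mem_Icc.1 hu).2)
  -- Below the lower limit m-n one has m-u > n, so the weight with n trials vanishes and the sum may
  -- start at 0.
  · intro u hu1 hu2
    have h1 : u < min m l + 1 := Finset.mem_range.1 hu1
    have h2 : n < m - u := by
      by_contra hn
      exact hu2 (Finset.mem_Icc.2 ⟨by omega, by omega⟩)
    rw [binomWeight_eq_zero h2]
    simp

lemma gnGamma_eq_zero (Ω α : ℝ) {m n k l : ℕ} (h : m + k ≠ n + l) : gnGamma Ω α m n k l = 0 :=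
  if_neg h

lemma binomialKernel_swap (r q : ℝ) (m n k l : ℕ) :
    binomialKernel r q l k n m = binomialKernel r q m n k l := by
  rw [binomialKernel, binomialKernel, min_comm]
  refine Finset.sum_congr rfl fun u _ => ?_
  congr 1
  ring

lemma gnGamma_swap {Ω α : ℝ} (hΩ0 : 0 < Ω) (hΩ1 : Ω < 1) (hα0 : 0 < α)
    (hα1 : α < 1) (m n k l : ℕ) : gnGamma Ω α l k n m = gnGamma Ω α m n k l := by
  have hC := gnC_pos hΩ0 hΩ1
  have hδ : α / (1 + gnC Ω * α) * (1 + gnC Ω * α) = α := div_mul_cancel₀ _ (by positivity)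
  by_cases h : m + k = n + l
  · rw [gnGamma_eq_binomialKernel hΩ0 hΩ1 hα0 hα1 hδ h,
      gnGamma_eq_binomialKernel hΩ0 hΩ1 hα0 hα1 hδ (by omega), binomialKernel_swap]
  · rw [gnGamma_eq_zero _ _ h, gnGamma_eq_zero _ _ (by omega)]

/-! ### Cancellations in the commutators -/

/-- The part of the commutator of `Γ` with a coordinate supported on `k + 1 = l + (n - m)`. -/
noncomputable def lowerComm (Γ : ℕ → ℕ → ℕ → ℕ → ℝ) (m n k l : ℕ) : ℝ :=
  (Real.sqrt (m + 1) * Γ (m + 1) n k l - Real.sqrt l * Γ m n k (l - 1)) +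
    (Real.sqrt n * Γ m (n - 1) k l - Real.sqrt (k + 1) * Γ m n (k + 1) l)

lemma binomWeight_succ_mul (N v : ℕ) (r : ℝ) :
    ((N : ℝ) + 1 - v) * binomWeight (N + 1) r v = (N + 1) * (1 - r) * binomWeight N r v := by
  rcases lt_trichotomy v (N + 1) with h | h | h
  · have h1 : ((N.choose v : ℕ) : ℝ) * (N + 1) = (N + 1).choose v * ((N : ℝ) + 1 - v) := by
      have := Nat.choose_mul_succ_eq N v
      have h2 : ((N + 1 - v : ℕ) : ℝ) = (N : ℝ) + 1 - v := by
        rw [Nat.cast_sub h.le]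
        push_cast
        ring
      rw [← h2]
      exact_mod_cast this
    rw [binomWeight, binomWeight, show N + 1 - v = N - v + 1 by omega, pow_succ]
    linear_combination -r ^ v * (1 - r) ^ (N - v) * (1 - r) * h1
  · subst h
    rw [binomWeight_eq_zero (Nat.lt_succ_self N)]
    push_cast
    ring
  · rw [binomWeight_eq_zero h, binomWeight_eq_zero (by omega)]
    ring

/-- The source of the gain √r: the deviation over √N is √r times the deviation in units of √(Nr),
which moves inside the square root. -/
lemma sqrt_binomWeight_mul_abs_eq {N : ℕ} {r R : ℝ} (hN : 0 < N) (hr : 0 < r)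
    (v : ℕ) : Real.sqrt (binomWeight N r v * R) * (|(v : ℝ) - N * r| / Real.sqrt N) =
      Real.sqrt r * Real.sqrt (deviationWeight N r v * R) := by
  have hN' : (0 : ℝ) < N := Nat.cast_pos.2 hN
  rw [← Real.sqrt_sq_eq_abs, ← Real.sqrt_div (sq_nonneg _), mul_comm,
    ← Real.sqrt_mul (by positivity), ← Real.sqrt_mul hr.le, deviationWeight]
  congr 1
  field_simp

/-- Raising both m and l by one at fixed m-u and l-u multiplies each weight by a rational factor
with the same denominator u+1; hence their geometric mean has a factor free of square roots in u. -/
lemma sqrt_mul_sqrt_lower_eq {r : ℝ} (hr0 : 0 ≤ r) (hr : r < 1) {m l u : ℕ} {R : ℝ}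
    (hR : 0 ≤ R) (hm : u ≤ m) (hl : u ≤ l) :
    Real.sqrt (l + 1) * Real.sqrt (binomWeight m r (m - u) * binomWeight l r (l - u) * R) =
    Real.sqrt (binomWeight (m + 1) r (m - u) * binomWeight (l + 1) r (l - u) * R) *
      ((u + 1) / ((1 - r) * Real.sqrt (m + 1))) := by
  have h1r : 0 < 1 - r := by linarith
  have e1 := binomWeight_succ_mul m (m - u) r
  have e2 := binomWeight_succ_mul l (l - u) r
  rw [Nat.cast_sub hm, show (m : ℝ) + 1 - (m - u) = u + 1 by ring] at e1
  rw [Nat.cast_sub hl, show (l : ℝ) + 1 - (l - u) = u + 1 by ring] at e2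
  have n1 := binomWeight_nonneg hr0 hr.le (m + 1) (m - u)
  have n2 := binomWeight_nonneg hr0 hr.le (l + 1) (l - u)
  have hc : 0 ≤ (u + 1) / ((1 - r) * Real.sqrt (m + 1)) := by positivity
  rw [← Real.sqrt_mul (by positivity), ← Real.sqrt_sq hc, ← Real.sqrt_mul (by positivity),
    div_pow, mul_pow, Real.sq_sqrt (by positivity)]
  congr 1
  field_simp
  linear_combination (-(1 - r) * R * (l + 1) * binomWeight l r (l - u)) * e1 -
    (u + 1) * R * binomWeight (m + 1) r (m - u) * e2

/-- After the shift u → u+1 in the second sum, both sums run over the same square roots. The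
coefficients differ by a multiple of (m+1)(1-r) - u, which is the deviation of m+1-u from its mean
(m+1)r. -/
lemma binomialKernel_lower_fst {r q : ℝ} (hr0 : 0 < r) (hr : r < 1) (hq0 : 0 ≤ q) (hq : q < 1)
    (m n k l : ℕ) :
    |Real.sqrt (m + 1) * binomialKernel r q (m + 1) n k l -
      Real.sqrt l * binomialKernel r q m n k (l - 1)| ≤ Real.sqrt r / (1 - r) *
      ∑ u ∈ Finset.range (min (m + 1) l + 1), Real.sqrt (deviationWeight (m + 1) r (m + 1 - u) *
        binomWeight n q (m + 1 - u) * binomWeight l r (l - u) * binomWeight k q (l - u)) := by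
  have h1r : 0 < 1 - r := by linarith
  have hs : 0 < Real.sqrt ((m : ℝ) + 1) := Real.sqrt_pos.2 (by positivity)
  have hss : Real.sqrt ((m : ℝ) + 1) * Real.sqrt ((m : ℝ) + 1) = m + 1 :=
    Real.mul_self_sqrt (by positivity)
  obtain ⟨F, hF⟩ : ∃ F : ℕ → ℝ, F = fun u => Real.sqrt (binomWeight (m + 1) r (m + 1 - u) *
    binomWeight n q (m + 1 - u) * binomWeight l r (l - u) * binomWeight k q (l - u)) := ⟨_, rfl⟩
  have hdiff : Real.sqrt (m + 1) * binomialKernel r q (m + 1) n k l -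
      Real.sqrt l * binomialKernel r q m n k (l - 1) =
      ∑ u ∈ Finset.range (min (m + 1) l + 1),
        F u * (((m + 1) * (1 - r) - u) / ((1 - r) * Real.sqrt (m + 1))) := by
    have hfirst : Real.sqrt (m + 1) * binomialKernel r q (m + 1) n k l =
        ∑ u ∈ Finset.range (min (m + 1) l + 1), F u * Real.sqrt (m + 1) := by
      rw [binomialKernel, Finset.mul_sum, hF]
      exact Finset.sum_congr rfl fun u _ => mul_comm _ _
    have hsecond : Real.sqrt l * binomialKernel r q m n k (l - 1) =
        ∑ u ∈ Finset.range (min (m + 1) l + 1),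
          F u * (u / ((1 - r) * Real.sqrt (m + 1))) := by
      rcases l with _ | l
      · simp
      -- The term u = 0 of the longer sum carries the coefficient u and vanishes, so the shift loses
      -- nothing.
      rw [Nat.add_min_add_right, Finset.sum_range_succ', Nat.add_sub_cancel, binomialKernel,
        Finset.mul_sum]
      simp only [Nat.cast_zero, zero_div, mul_zero, add_zero]
      refine Finset.sum_congr rfl fun u hu => ?_
      have hu' : u < min m l + 1 := Finset.mem_range.1 hu
      have n1 := binomWeight_nonneg hq0 hq.le n (m - u)
      have n2 := binomWeight_nonneg hq0 hq.le k (l - u)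
      have key := sqrt_mul_sqrt_lower_eq hr0.le hr
        (R := binomWeight n q (m - u) * binomWeight k q (l - u))
        (mul_nonneg n1 n2) (show u ≤ m by omega) (show u ≤ l by omega)
      rw [hF]
      push_cast
      convert key using 3 <;> ring
    rw [hfirst, hsecond, ← Finset.sum_sub_distrib]
    refine Finset.sum_congr rfl fun u _ => ?_
    rw [← mul_sub]
    congr 1
    field_simp
    rw [Real.sq_sqrt (by positivity)]
  rw [hdiff, Finset.mul_sum]
  refine (Finset.abs_sum_le_sum_abs _ _).trans (Finset.sum_le_sum fun u hu => le_of_eq ?_)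
  have hu' : u < min (m + 1) l + 1 := Finset.mem_range.1 hu
  have key := sqrt_binomWeight_mul_abs_eq (N := m + 1) (R := binomWeight n q (m + 1 - u) *
    (binomWeight l r (l - u) * binomWeight k q (l - u))) (Nat.succ_pos m) hr0 (m + 1 - u)
  simp only [← mul_assoc] at key
  rw [abs_mul, abs_of_nonneg (by rw [hF]; exact Real.sqrt_nonneg _), abs_div,
    abs_of_pos (mul_pos h1r hs), div_mul_eq_mul_div, ← key, hF, Nat.cast_sub (by omega)]
  push_cast
  rw [show (m : ℝ) + 1 - u - (m + 1) * r = (m + 1) * (1 - r) - u by ring]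
  field_simp

/-- Here no shift of u is needed. The selection rule makes n-(m-u) equal to (k+1)-(l-u), so the
factors from n and k combine without square roots in u, and the deviation is that of l-u from
(k+1)q. -/
lemma binomialKernel_lower_snd {r q : ℝ} (hr0 : 0 ≤ r) (hr : r < 1) (hq0 : 0 < q) (hq : q < 1)
    {m n k l : ℕ} (h : k + 1 + m = n + l) :
    |Real.sqrt n * binomialKernel r q m (n - 1) k l -
      Real.sqrt (k + 1) * binomialKernel r q m n (k + 1) l| ≤ Real.sqrt q / (1 - q) *
      ∑ u ∈ Finset.range (min m l + 1), Real.sqrt (binomWeight m r (m - u) *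
        binomWeight n q (m - u) * binomWeight l r (l - u) * deviationWeight (k + 1) q (l - u)) := by
  have h1q : 0 < 1 - q := by linarith
  have hs : 0 < Real.sqrt ((k : ℝ) + 1) := Real.sqrt_pos.2 (by positivity)
  have hss : Real.sqrt ((k : ℝ) + 1) * Real.sqrt ((k : ℝ) + 1) = k + 1 :=
    Real.mul_self_sqrt (by positivity)
  obtain ⟨F, hF⟩ : ∃ F : ℕ → ℝ, F = fun u => Real.sqrt (binomWeight m r (m - u) *
    binomWeight n q (m - u) * binomWeight l r (l - u) * binomWeight (k + 1) q (l - u)) := ⟨_, rfl⟩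
  have hfirst : Real.sqrt n * binomialKernel r q m (n - 1) k l =
      ∑ u ∈ Finset.range (min m l + 1),
        F u * (((k : ℝ) + 1 - (l - u : ℕ)) / ((1 - q) * Real.sqrt (k + 1))) := by
    rw [binomialKernel, Finset.mul_sum]
    refine Finset.sum_congr rfl fun u hu => ?_
    have hu' : u < min m l + 1 := Finset.mem_range.1 hu
    have hz : (n : ℝ) - (m - u : ℕ) = k + 1 - (l - u : ℕ) := by
      rw [Nat.cast_sub (by omega), Nat.cast_sub (by omega)]
      have : (k : ℝ) + 1 + m = n + l := by exact_mod_cast h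
      linarith
    have n1 := binomWeight_nonneg hr0 hr.le m (m - u)
    have n2 := binomWeight_nonneg hr0 hr.le l (l - u)
    have n3 := fun N v => binomWeight_nonneg hq0.le hq.le N v
    have ek := binomWeight_succ_mul k (l - u) q
    rw [hF]
    rcases lt_or_ge (k + 1) (l - u) with hw | hw
    · simp [binomWeight_eq_zero hw, binomWeight_eq_zero (show k < l - u by omega)]
    have hz0 : (0 : ℝ) ≤ k + 1 - (l - u : ℕ) := by
      have : ((l - u : ℕ) : ℝ) ≤ ((k + 1 : ℕ) : ℝ) := Nat.cast_le.2 hw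
      push_cast at this
      linarith
    have hc : 0 ≤ ((k : ℝ) + 1 - (l - u : ℕ)) / ((1 - q) * Real.sqrt (k + 1)) := by positivity
    -- For n = 0 the index n-1 is truncated, but √n kills the left side; on the right the
    -- coefficient vanishes by the selection rule.
    rcases n with _ | n
    · have : (k : ℝ) + 1 - (l - u : ℕ) = 0 := by
        have : (0 : ℝ) ≤ (m - u : ℕ) := Nat.cast_nonneg _
        push_cast at hz
        linarith
      rw [this]
      simp
    have en := binomWeight_succ_mul n (m - u) q
    push_cast at hz
    rw [hz] at en
    have n4 := n3 n (m - u)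
    have n5 := n3 k (l - u)
    have n6 := n3 (n + 1) (m - u)
    have n7 := n3 (k + 1) (l - u)
    rw [Nat.add_sub_cancel, ← Real.sqrt_mul (by positivity)]
    dsimp only
    rw [← Real.sqrt_sq hc, ← Real.sqrt_mul (by positivity), div_pow, mul_pow,
      Real.sq_sqrt (by positivity)]
    congr 1
    push_cast
    field_simp
    linear_combination (-(1 - q) * (k + 1) * binomWeight m r (m - u) * binomWeight l r (l - u) *
      binomWeight k q (l - u)) * en - (k + 1 - (l - u : ℕ)) * binomWeight m r (m - u) *
      binomWeight l r (l - u) * binomWeight (n + 1) q (m - u) * ek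
  have hsecond : Real.sqrt (k + 1) * binomialKernel r q m n (k + 1) l =
      ∑ u ∈ Finset.range (min m l + 1), F u * Real.sqrt (k + 1) := by
    rw [binomialKernel, Finset.mul_sum, hF]
    exact Finset.sum_congr rfl fun u _ => mul_comm _ _
  rw [hfirst, hsecond, ← Finset.sum_sub_distrib, Finset.mul_sum]
  refine (Finset.abs_sum_le_sum_abs _ _).trans (Finset.sum_le_sum fun u hu => le_of_eq ?_)
  have key := sqrt_binomWeight_mul_abs_eq (N := k + 1) (R := binomWeight m r (m - u) *
    (binomWeight n q (m - u) * binomWeight l r (l - u))) (Nat.succ_pos k) hq0 (l - u)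
  have hcoef : ((k : ℝ) + 1 - (l - u : ℕ)) / ((1 - q) * Real.sqrt (k + 1)) - Real.sqrt (k + 1) =
      -(((l - u : ℕ) : ℝ) - (k + 1) * q) / Real.sqrt (k + 1) / (1 - q) := by
    field_simp
    rw [Real.sq_sqrt (by positivity)]
    ring
  push_cast at key
  rw [← mul_sub, hcoef, abs_mul, abs_of_nonneg (by rw [hF]; exact Real.sqrt_nonneg _), abs_div,
    abs_div, abs_of_pos h1q, abs_of_pos hs, abs_neg, hF, div_mul_eq_mul_div,
    show binomWeight m r (m - u) * binomWeight n q (m - u) * binomWeight l r (l - u) *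
      deviationWeight (k + 1) q (l - u) = deviationWeight (k + 1) q (l - u) *
      (binomWeight m r (m - u) * (binomWeight n q (m - u) * binomWeight l r (l - u))) by ring,
    ← key, mul_div_assoc]
  congr 2
  dsimp only
  congr 1
  ring

lemma lowerComm_eq_zero (Ω α : ℝ) {m n k l : ℕ} (h : k + 1 + m ≠ n + l) :
    lowerComm (gnGamma Ω α) m n k l = 0 := by
  rw [lowerComm, gnGamma_eq_zero _ _ (by omega), gnGamma_eq_zero Ω α (n := n) (k := k + 1) (by omega)]
  have h1 : Real.sqrt l * gnGamma Ω α m n k (l - 1) = 0 := by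
    rcases l with _ | l
    · simp
    · rw [gnGamma_eq_zero _ _ (by omega), mul_zero]
  have h2 : Real.sqrt n * gnGamma Ω α m (n - 1) k l = 0 := by
    rcases n with _ | n
    · simp
    · rw [gnGamma_eq_zero _ _ (by omega), mul_zero]
  rw [h1, h2]
  ring

lemma abs_lowerComm_le {Ω α : ℝ} (hΩ0 : 0 < Ω) (hΩ1 : Ω < 1) (hα0 : 0 < α) (hα1 : α < 1)
    {δ : ℝ} (hδ : δ * (1 + gnC Ω * α) = α) (hr : (1 + gnC Ω) * δ < 1) (hδ0 : 0 < δ)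
    {m n k l : ℕ} (h : k + 1 + m = n + l) :
    |lowerComm (gnGamma Ω α) m n k l| ≤
      Real.sqrt ((1 + gnC Ω) * δ) / (1 - (1 + gnC Ω) * δ) *
      ((∑ u ∈ Finset.range (min (m + 1) l + 1),
        Real.sqrt (deviationWeight (m + 1) ((1 + gnC Ω) * δ) (m + 1 - u) *
        binomWeight n (gnC Ω * δ) (m + 1 - u) * binomWeight l ((1 + gnC Ω) * δ) (l - u) *
        binomWeight k (gnC Ω * δ) (l - u))) +
      ∑ u ∈ Finset.range (min m l + 1), Real.sqrt (binomWeight m ((1 + gnC Ω) * δ) (m - u) *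
        binomWeight n (gnC Ω * δ) (m - u) * binomWeight l ((1 + gnC Ω) * δ) (l - u) *
        deviationWeight (k + 1) (gnC Ω * δ) (l - u))) := by
  have hC := gnC_pos hΩ0 hΩ1
  have hq0 : 0 < gnC Ω * δ := by positivity
  have hqr : gnC Ω * δ ≤ (1 + gnC Ω) * δ := by nlinarith
  have e1 : Real.sqrt (m + 1) * gnGamma Ω α (m + 1) n k l = Real.sqrt (m + 1) *
      binomialKernel ((1 + gnC Ω) * δ) (gnC Ω * δ) (m + 1) n k l := by
    rw [gnGamma_eq_binomialKernel hΩ0 hΩ1 hα0 hα1 hδ (by omega)]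
  have e2 : Real.sqrt l * gnGamma Ω α m n k (l - 1) = Real.sqrt l *
      binomialKernel ((1 + gnC Ω) * δ) (gnC Ω * δ) m n k (l - 1) := by
    rcases l with _ | l
    · simp
    · rw [gnGamma_eq_binomialKernel hΩ0 hΩ1 hα0 hα1 hδ (by omega)]
  have e3 : Real.sqrt n * gnGamma Ω α m (n - 1) k l = Real.sqrt n *
      binomialKernel ((1 + gnC Ω) * δ) (gnC Ω * δ) m (n - 1) k l := by
    rcases n with _ | n
    · simp
    · rw [gnGamma_eq_binomialKernel hΩ0 hΩ1 hα0 hα1 hδ (by omega)]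
  have e4 : Real.sqrt (k + 1) * gnGamma Ω α m n (k + 1) l = Real.sqrt (k + 1) *
      binomialKernel ((1 + gnC Ω) * δ) (gnC Ω * δ) m n (k + 1) l := by
    rw [gnGamma_eq_binomialKernel hΩ0 hΩ1 hα0 hα1 hδ (by omega)]
  rw [lowerComm, e1, e2, e3, e4, mul_add]
  refine (abs_add_le _ _).trans (add_le_add
    (binomialKernel_lower_fst (by positivity) hr hq0.le (by linarith) m n k l)
    ((binomialKernel_lower_snd (by positivity) hr hq0 (by linarith) h).trans ?_))
  gcongr

/-! ### Bounds on Γ and on its commutators at fixed α -/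

lemma binomialKernel_le {C α e δ b c : ℝ} {m h p k : ℕ} (H : KernelRange C α m h p k e)
    (hδ : δ * (1 + C * α) = α) (hb0 : 0 < b) (hb : b ≤ 1 / 2) (hbC : b ≤ C / 4)
    (hc : c = 1 / (768 * (1 + 2 * C))) :
    binomialKernel ((1 + C) * δ) (C * δ) m (m + h) k (m + p) ≤
      16 * 2048 ^ 2 / b * decayProfile C α c k h p := by
  obtain ⟨-, -, hδ0, hδα, -, -⟩ := small_parameter_bounds H.C_pos H.α_pos H.α_small hδ
  have hC := H.C_pos
  have hsm := H.α_small
  have hr : (1 + C) * δ ≤ 1 / 10 := by nlinarith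
  have hq : C * δ ≤ 1 / 10 := by nlinarith
  have B1 := fun N => (hasPoissonBounds_binomWeight (by positivity) hr N).mono
    (show (4 : ℝ) ≤ 2048 by norm_num)
  have B2 := fun N => (hasPoissonBounds_binomWeight (by positivity) hq N).mono
    (show (4 : ℝ) ≤ 2048 by norm_num)
  exact H.sum_le (by push_cast; ring_nf; simp) hδ (by norm_num) (B1 m)
    (by have := B2 (m + h); push_cast at this; exact this)
    (by have := B1 (m + p); push_cast at this; exact this) (B2 k) hb0 hb hbC hc

lemma hasPoissonBounds_deviationWeight_succ {r : ℝ} (h0 : 0 < r) (h1 : r ≤ 1 / 10) (N : ℕ) :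
    HasPoissonBounds 2048 (N * r) (deviationWeight (N + 1) r) := by
  have h := hasPoissonBounds_deviationWeight h0 h1 (Nat.succ_pos N)
  rw [show (2048 : ℝ) = 8 * 256 by norm_num]
  refine h.of_mean_sub_le (by norm_num) ?_ ?_ <;> push_cast <;> linarith

lemma abs_lowerComm_le_decayProfile {Ω α : ℝ} (hΩ0 : 0 < Ω) (hΩ1 : Ω < 1) (hα0 : 0 < α)
    (hsm : (1 + 2 * gnC Ω) * α ≤ 1 / 10) {b c : ℝ} (hb0 : 0 < b) (hb : b ≤ 1 / 2)
    (hbC : b ≤ gnC Ω / 4) (hc : c = 1 / (768 * (1 + 2 * gnC Ω))) (m h p k : ℕ) :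
    |lowerComm (gnGamma Ω α) m (m + h) k (m + p)| ≤ 64 * 2048 ^ 2 / b *
      Real.sqrt (1 + gnC Ω) * Real.sqrt α * decayProfile (gnC Ω) α c k h p ∧
    |lowerComm (gnGamma Ω α) (m + p) k (m + h) m| ≤ 64 * 2048 ^ 2 / b *
      Real.sqrt (1 + gnC Ω) * Real.sqrt α * decayProfile (gnC Ω) α c k h p := by
  have hC := gnC_pos hΩ0 hΩ1
  set C := gnC Ω with hCdef
  have hδ : α / (1 + C * α) * (1 + C * α) = α := div_mul_cancel₀ _ (by positivity)
  set δ := α / (1 + C * α) with hδdef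
  obtain ⟨hα1, -, hδ0, hδα, -, -⟩ := small_parameter_bounds hC hα0 hsm hδ
  have hr : (1 + C) * δ ≤ 1 / 10 := by nlinarith
  have hq : C * δ ≤ 1 / 10 := by nlinarith
  have hr0 : 0 < (1 + C) * δ := by positivity
  have hq0 : 0 < C * δ := by positivity
  have hD : 0 ≤ decayProfile C α c k h p := by
    unfold decayProfile
    positivity
  have B1 := fun N => (hasPoissonBounds_binomWeight hr0.le hr N).mono
    (show (4 : ℝ) ≤ 2048 by norm_num)
  have B2 := fun N => (hasPoissonBounds_binomWeight hq0.le hq N).mono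
    (show (4 : ℝ) ≤ 2048 by norm_num)
  have D1 := hasPoissonBounds_deviationWeight_succ hr0 hr
  have D2 := hasPoissonBounds_deviationWeight_succ hq0 hq
  have hprefac : Real.sqrt ((1 + C) * δ) / (1 - (1 + C) * δ) ≤
      2 * (Real.sqrt (1 + C) * Real.sqrt α) := by
    rw [div_le_iff₀ (by linarith), ← Real.sqrt_mul (by positivity)]
    have h1 : Real.sqrt ((1 + C) * δ) ≤ Real.sqrt ((1 + C) * α) :=
      Real.sqrt_le_sqrt (by gcongr)
    nlinarith [Real.sqrt_nonneg ((1 + C) * α)]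
  have hfin : ∀ S₁ S₂ x : ℝ, S₁ ≤ 16 * 2048 ^ 2 / b * decayProfile C α c k h p →
      S₂ ≤ 16 * 2048 ^ 2 / b * decayProfile C α c k h p →
      x ≤ Real.sqrt ((1 + C) * δ) / (1 - (1 + C) * δ) * (S₁ + S₂) →
      x ≤ 64 * 2048 ^ 2 / b * Real.sqrt (1 + C) * Real.sqrt α * decayProfile C α c k h p := by
    intro S₁ S₂ x h1 h2 hx
    have h0 : 0 ≤ Real.sqrt ((1 + C) * δ) / (1 - (1 + C) * δ) :=
      div_nonneg (Real.sqrt_nonneg _) (by linarith)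
    calc x ≤ Real.sqrt ((1 + C) * δ) / (1 - (1 + C) * δ) *
          (16 * 2048 ^ 2 / b * decayProfile C α c k h p +
            16 * 2048 ^ 2 / b * decayProfile C α c k h p) := hx.trans (by gcongr)
      _ ≤ 2 * (Real.sqrt (1 + C) * Real.sqrt α) *
          (16 * 2048 ^ 2 / b * decayProfile C α c k h p +
            16 * 2048 ^ 2 / b * decayProfile C α c k h p) := by gcongr
      _ = _ := by ring
  have cast2 : HasPoissonBounds 2048 ((m + h) * (C * δ)) (binomWeight (m + h) (C * δ)) := by
    have := B2 (m + h)
    push_cast at this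
    exact this
  have cast3 : HasPoissonBounds 2048 ((m + p) * ((1 + C) * δ))
      (binomWeight (m + p) ((1 + C) * δ)) := by
    have := B1 (m + p)
    push_cast at this
    exact this
  have castD2 : HasPoissonBounds 2048 ((m + h) * (C * δ))
      (deviationWeight (m + h + 1) (C * δ)) := by
    have := D2 (m + h)
    push_cast at this
    exact this
  have castD3 : HasPoissonBounds 2048 ((m + p) * ((1 + C) * δ))
      (deviationWeight (m + p + 1) ((1 + C) * δ)) := by
    have := D1 (m + p)
    push_cast at this
    exact this
  constructor
  · by_cases hk : k + 1 + m = m + h + (m + p)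
    swap
    · rw [lowerComm_eq_zero _ _ hk, abs_zero]
      positivity
    -- The two components live on k = m+h+p∓1; this one has offset -1, the reversed one +1.
    have H : KernelRange C α m h p k (-1) := by
      refine ⟨hC, hα0, hsm, ?_, by norm_num⟩
      have : (k : ℝ) + 1 + m = m + h + (m + p) := by exact_mod_cast hk
      linarith
    refine hfin _ _ _ ?_ ?_
      (abs_lowerComm_le hΩ0 hΩ1 hα0 (by linarith) hδ (by linarith) hδ0 hk)
    · exact H.sum_le (by push_cast; ring_nf; simp) hδ (by norm_num) (D1 m) cast2 cast3 (B2 k)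
        hb0 hb hbC hc
    · exact H.sum_le (by push_cast; ring_nf; simp) hδ (by norm_num) (B1 m) cast2 cast3 (D2 k)
        hb0 hb hbC hc
  · by_cases hk : m + h + 1 + (m + p) = k + m
    swap
    · rw [lowerComm_eq_zero _ _ hk, abs_zero]
      positivity
    have H : KernelRange C α m h p k 1 := by
      refine ⟨hC, hα0, hsm, ?_, by norm_num⟩
      have : (m : ℝ) + h + 1 + (m + p) = k + m := by exact_mod_cast hk
      linarith
    refine hfin _ _ _ ?_ ?_
      (abs_lowerComm_le hΩ0 hΩ1 hα0 (by linarith) hδ (by linarith) hδ0 hk)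
    -- With the indices reversed, the pair at the larger index comes first; `min_comm` and a
    -- permutation of the factors restore the order expected by `KernelRange.sum_le`.
    · refine le_trans (le_of_eq ?_) (H.sum_le (m' := m) (l' := m + p + 1)
        (by push_cast; ring_nf; simp) hδ (by norm_num) (B1 m) cast2 castD3 (B2 k) hb0 hb hbC hc)
      rw [min_comm]
      refine Finset.sum_congr rfl fun u _ => ?_
      congr 1
      ring
    · refine le_trans (le_of_eq ?_) (H.sum_le (m' := m) (l' := m + p)
        (by push_cast; ring_nf; simp) hδ (by norm_num) (B1 m) castD2 cast3 (B2 k) hb0 hb hbC hc)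
      rw [min_comm]
      refine Finset.sum_congr rfl fun u _ => ?_
      congr 1
      ring

lemma gnGamma_le_decayProfile {Ω α : ℝ} (hΩ0 : 0 < Ω) (hΩ1 : Ω < 1) (hα0 : 0 < α)
    (hsm : (1 + 2 * gnC Ω) * α ≤ 1 / 10) {b c : ℝ} (hb0 : 0 < b) (hb : b ≤ 1 / 2)
    (hbC : b ≤ gnC Ω / 4) (hc : c = 1 / (768 * (1 + 2 * gnC Ω))) (m h p k : ℕ) :
    |gnGamma Ω α m (m + h) k (m + p)| ≤
      16 * 2048 ^ 2 / b * decayProfile (gnC Ω) α c k h p := by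
  have hC := gnC_pos hΩ0 hΩ1
  have hδ : α / (1 + gnC Ω * α) * (1 + gnC Ω * α) = α := div_mul_cancel₀ _ (by positivity)
  obtain ⟨hα1, -⟩ := small_parameter_bounds hC hα0 hsm hδ
  by_cases hk : m + k = m + h + (m + p)
  · have H : KernelRange (gnC Ω) α m h p k 0 := by
      refine ⟨hC, hα0, hsm, ?_, by norm_num⟩
      have : (m : ℝ) + k = m + h + (m + p) := by exact_mod_cast hk
      linarith
    rw [gnGamma_eq_binomialKernel hΩ0 hΩ1 hα0 (by linarith) hδ hk, abs_of_nonneg]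
    · exact binomialKernel_le H hδ hb0 hb hbC hc
    · exact Finset.sum_nonneg fun _ _ => Real.sqrt_nonneg _
  · rw [gnGamma_eq_zero _ _ hk, abs_zero]
    have hc0 : 0 < c := by rw [hc]; positivity
    unfold decayProfile
    positivity

/-- On a slice α and ε are comparable up to the factor M, and replacing c by c/M absorbs the only
loss, in the denominator 1+kα. -/
lemma decayProfile_le {C α ε c M : ℝ} (hε : 0 < ε) (hεα : ε ≤ α) (hM : 1 ≤ M)
    (hαM : α ≤ M * ε) (hc : 0 ≤ c) (k h p : ℕ) :
    decayProfile C α c k h p ≤ decayProfile C ε (c / M) k h p := by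
  have hM0 : 0 < M := by linarith
  have hα : 0 < α := by linarith
  have hk0 : (0 : ℝ) ≤ k := Nat.cast_nonneg k
  have hcM : c / M ≤ c := div_le_self hc hM
  have hkε : k * ε ≤ k * α := by gcongr
  have hkε0 : 0 ≤ k * ε := by positivity
  have h1 : c / M * (p : ℝ) ^ 2 / (1 + k * ε) ≤ c * (p : ℝ) ^ 2 / (1 + k * α) := by
    rw [div_mul_eq_mul_div, div_div]
    refine div_le_div_of_nonneg_left (by positivity) (by positivity) ?_
    have : k * α ≤ k * (M * ε) := by gcongr
    nlinarith
  have h2 : c / M * ε / (1 + k) * ((h : ℝ) - k / (1 + C)) ^ 2 ≤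
      c * α / (1 + k) * ((h : ℝ) - k / (1 + C)) ^ 2 := by gcongr
  have h3 : c / M * k * ε ≤ c * k * α := by gcongr
  have h4 : c / M * p ≤ c * p := by gcongr
  unfold decayProfile
  gcongr ?_ + ?_
  · refine div_le_div₀ (Real.exp_pos _).le (Real.exp_le_exp.2 (by linarith)) (by positivity) ?_
    gcongr
  · exact Real.exp_le_exp.2 (by linarith)

/-- By the symmetry of Γ, the four terms not in `lowerComm` at (m,n,k,l) are minus `lowerComm` at
the reversed indices; for x¹ the sign is plus. -/
lemma norm_gnComm0_le {Ω θ α : ℝ} (hΩ0 : 0 < Ω) (hΩ1 : Ω < 1) (hα0 : 0 < α) (hα1 : α < 1)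
    (hθ : 0 < θ) (m n k l : ℕ) :
    ‖gnComm0 θ (gnGamma Ω α) m n k l‖ ≤ 2 * Real.pi * θ * Real.sqrt (θ / 8) *
      (|lowerComm (gnGamma Ω α) m n k l| + |lowerComm (gnGamma Ω α) l k n m|) := by
  have hs := gnGamma_swap hΩ0 hΩ1 hα0 hα1
  have : 0 ≤ 2 * Real.pi * θ * Real.sqrt (θ / 8) := by positivity
  rw [gnComm0, norm_mul, Complex.norm_real, Complex.norm_real, Real.norm_of_nonneg this,
    Real.norm_eq_abs]
  refine mul_le_mul_of_nonneg_left (le_trans (le_of_eq ?_) (abs_sub _ _)) this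
  congr 1
  simp only [lowerComm, hs]
  ring

lemma norm_gnComm1_le {Ω θ α : ℝ} (hΩ0 : 0 < Ω) (hΩ1 : Ω < 1) (hα0 : 0 < α) (hα1 : α < 1)
    (hθ : 0 < θ) (m n k l : ℕ) :
    ‖gnComm1 θ (gnGamma Ω α) m n k l‖ ≤ 2 * Real.pi * θ * Real.sqrt (θ / 8) *
      (|lowerComm (gnGamma Ω α) m n k l| + |lowerComm (gnGamma Ω α) l k n m|) := by
  have hs := gnGamma_swap hΩ0 hΩ1 hα0 hα1
  have : 0 ≤ 2 * Real.pi * θ * Real.sqrt (θ / 8) := by positivity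
  rw [gnComm1, norm_mul, norm_mul, Complex.norm_I, one_mul, Complex.norm_real, Complex.norm_real,
    Real.norm_of_nonneg this, Real.norm_eq_abs]
  refine mul_le_mul_of_nonneg_left (le_trans (le_of_eq ?_) (abs_add_le _ _)) this
  congr 1
  simp only [lowerComm, hs]
  ring

/-! ### Spinor matrices and integration over a slice -/

lemma IsGammaPair.mem_unitaryGroup {γ0 γ1 : Matrix (Fin 2) (Fin 2) ℂ} (h : IsGammaPair γ0 γ1) :
    γ0 ∈ Matrix.unitaryGroup (Fin 2) ℂ ∧ γ1 ∈ Matrix.unitaryGroup (Fin 2) ℂ := by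
  constructor <;> rw [Matrix.mem_unitaryGroup_iff, Matrix.star_eq_conjTranspose]
  · rw [h.skew_zero, mul_neg, h.sq_zero, neg_neg]
  · rw [h.skew_one, mul_neg, h.sq_one, neg_neg]

lemma half_le_sqrt_one_sub {α : ℝ} (hα1 : α ≤ 1 / 10) : 1 / 2 ≤ Real.sqrt (1 - α) :=
  Real.le_sqrt_of_sq_le (by linarith)

lemma norm_gnSpin_le {γ0 γ1 : Matrix (Fin 2) (Fin 2) ℂ} (h : IsGammaPair γ0 γ1) {α : ℝ}
    (hα0 : 0 < α) (hα1 : α ≤ 1 / 10) (a b : Fin 2) : ‖gnSpin α γ0 γ1 a b‖ ≤ 3 := by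
  have hs := half_le_sqrt_one_sub hα1
  have h1 : ‖((((2 - α) / (2 * Real.sqrt (1 - α)) : ℝ) : ℂ) • (1 : Matrix (Fin 2) (Fin 2) ℂ)) a b‖ ≤
      2 := by
    rw [Matrix.smul_apply, norm_smul, Complex.norm_real, Real.norm_of_nonneg
      (div_nonneg (by linarith) (by positivity))]
    have e1 : (2 - α) / (2 * Real.sqrt (1 - α)) ≤ 2 := by
      rw [div_le_iff₀ (by positivity)]
      linarith
    have e2 := entry_norm_bound_of_unitary (one_mem (Matrix.unitaryGroup (Fin 2) ℂ)) a b
    calc _ ≤ 2 * (1 : ℝ) := mul_le_mul e1 e2 (norm_nonneg _) (by norm_num)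
      _ = 2 := by norm_num
  have h2 : ‖((Complex.I * ((α / (2 * Real.sqrt (1 - α)) : ℝ) : ℂ)) • (γ0 * γ1)) a b‖ ≤ 1 := by
    rw [Matrix.smul_apply, norm_smul, norm_mul, Complex.norm_I, one_mul, Complex.norm_real,
      Real.norm_of_nonneg (by positivity)]
    have e1 : α / (2 * Real.sqrt (1 - α)) ≤ 1 := by
      rw [div_le_iff₀ (by positivity)]
      linarith
    have e2 := entry_norm_bound_of_unitary (mul_mem h.mem_unitaryGroup.1 h.mem_unitaryGroup.2) a b
    calc _ ≤ 1 * (1 : ℝ) := mul_le_mul e1 e2 (norm_nonneg _) (by norm_num)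
      _ = 1 := by norm_num
  rw [gnSpin, Matrix.sub_apply]
  exact (norm_sub_le _ _).trans (by linarith)

lemma norm_smul_gamma_add_le {γ0 γ1 : Matrix (Fin 2) (Fin 2) ℂ} (h : IsGammaPair γ0 γ1) {z w : ℂ}
    {Z : ℝ} (hz : ‖z‖ ≤ Z) (hw : ‖w‖ ≤ Z) (a b : Fin 2) :
    ‖(z • γ0 + w • γ1) a b‖ ≤ 2 * Z := by
  have e0 := entry_norm_bound_of_unitary h.mem_unitaryGroup.1 a b
  have e1 := entry_norm_bound_of_unitary h.mem_unitaryGroup.2 a b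
  rw [Matrix.add_apply, Matrix.smul_apply, Matrix.smul_apply]
  refine (norm_add_le _ _).trans ?_
  rw [norm_smul, norm_smul]
  have h1 := mul_le_of_le_one_right (norm_nonneg z) e0
  have h2 := mul_le_of_le_one_right (norm_nonneg w) e1
  linarith

/-- The coordinates contribute θ^(3/2), and both 2Ω/θ·(2-α)/α and 2Ω/θ are O(1/(θα)), which leaves
√θ/α. The gamma matrices are unitary, so their entries are at most 1. -/
lemma norm_gnAlphaComm_le {Ω θ α : ℝ} (hΩ0 : 0 < Ω) (hΩ1 : Ω < 1) (hα0 : 0 < α)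
    (hα1 : α ≤ 1 / 10) (hθ : 0 < θ) {γ0 γ1 : Matrix (Fin 2) (Fin 2) ℂ} (h : IsGammaPair γ0 γ1)
    {m n k l : ℕ} {Y : ℝ} (h1 : |lowerComm (gnGamma Ω α) m n k l| ≤ Y)
    (h2 : |lowerComm (gnGamma Ω α) l k n m| ≤ Y) (a b : Fin 2) :
    ‖gnAlphaComm Ω θ α γ0 γ1 m n k l a b‖ ≤ 288 * Real.pi * Real.sqrt θ * (Y / α) := by
  obtain ⟨Z, hZ⟩ : ∃ Z, Z = 2 * Real.pi * θ * Real.sqrt θ * (2 * Y) := ⟨_, rfl⟩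
  have hY : 0 ≤ Y := (abs_nonneg _).trans h1
  have hZ0 : 0 ≤ Z := by rw [hZ]; positivity
  have hsq : Real.sqrt (θ / 8) ≤ Real.sqrt θ := Real.sqrt_le_sqrt (by linarith)
  have hstep : 2 * Real.pi * θ * Real.sqrt (θ / 8) *
      (|lowerComm (gnGamma Ω α) m n k l| + |lowerComm (gnGamma Ω α) l k n m|) ≤ Z := by
    rw [hZ]
    gcongr
    linarith
  have c0 := (norm_gnComm0_le hΩ0 hΩ1 hα0 (by linarith) hθ m n k l).trans hstep
  have c1 := (norm_gnComm1_le hΩ0 hΩ1 hα0 (by linarith) hθ m n k l).trans hstep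
  have hfac : ∀ c, ‖((Complex.I * ((gnOmegaTilde Ω θ * ((2 - α) / α) : ℝ) : ℂ)) •
      gnSlashComm θ γ0 γ1 (gnGamma Ω α) m n k l
      + (Ω : ℂ) • gnSlashTildeComm θ γ0 γ1 (gnGamma Ω α) m n k l) a c‖ ≤ 12 * Z / (θ * α) := by
    intro c
    have s1 := norm_smul_gamma_add_le h c0 c1 a c
    have s2 := norm_smul_gamma_add_le h (z := -(gnComm1 θ (gnGamma Ω α) m n k l))
      (by rwa [norm_neg]) c0 a c
    have t1 : gnOmegaTilde Ω θ * ((2 - α) / α) ≤ 4 / (θ * α) := by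
      rw [gnOmegaTilde, div_mul_div_comm]
      refine div_le_div_of_nonneg_right ?_ (by positivity)
      nlinarith
    have t10 : 0 ≤ gnOmegaTilde Ω θ * ((2 - α) / α) := by
      rw [gnOmegaTilde]
      exact mul_nonneg (by positivity) (div_nonneg (by linarith) hα0.le)
    have t2 : Ω * (2 / θ) ≤ 2 / (θ * α) := by
      rw [mul_div_assoc', div_le_div_iff₀ hθ (by positivity)]
      have : Ω * α ≤ 1 := by nlinarith
      have := mul_le_mul_of_nonneg_right this hθ.le
      linarith
    rw [Matrix.add_apply, Matrix.smul_apply, Matrix.smul_apply, gnSlashTildeComm,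
      Matrix.smul_apply]
    refine (norm_add_le _ _).trans ?_
    rw [norm_smul, norm_smul, norm_smul, norm_mul, Complex.norm_I, one_mul, Complex.norm_real,
      Complex.norm_real, Complex.norm_real, Real.norm_of_nonneg t10, Real.norm_of_nonneg hΩ0.le,
      Real.norm_of_nonneg (by positivity), ← mul_assoc]
    calc _ ≤ 4 / (θ * α) * (2 * Z) + 2 / (θ * α) * (2 * Z) := by
          refine add_le_add (mul_le_mul t1 s1 (norm_nonneg _) (by positivity))
            (mul_le_mul t2 s2 (norm_nonneg _) (by positivity))
      _ = _ := by ring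
  rw [gnAlphaComm, Matrix.mul_apply]
  refine (norm_sum_le _ _).trans ?_
  calc _ ≤ ∑ c : Fin 2, 12 * Z / (θ * α) * 3 := by
        refine Finset.sum_le_sum fun c _ => ?_
        rw [norm_mul]
        exact mul_le_mul (hfac c) (norm_gnSpin_le h hα0 hα1 c b) (norm_nonneg _) (by positivity)
    _ = _ := by
      rw [hZ, Finset.sum_const, Finset.card_univ, Fintype.card_fin, nsmul_eq_mul]
      push_cast
      field_simp
      ring

lemma norm_gnAlphaMass_le {Ω μ α : ℝ} (hα0 : 0 < α)
    (hα1 : α ≤ 1 / 10) {γ0 γ1 : Matrix (Fin 2) (Fin 2) ℂ} (h : IsGammaPair γ0 γ1)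
    {m n k l : ℕ} {Y : ℝ} (h1 : |gnGamma Ω α m n k l| ≤ Y) (a b : Fin 2) :
    ‖gnAlphaMass Ω μ α γ0 γ1 m n k l a b‖ ≤ 3 * |μ| * Y := by
  rw [gnAlphaMass, Matrix.smul_apply, norm_smul, Complex.norm_real, Real.norm_eq_abs, abs_mul,
    abs_neg]
  have hY : 0 ≤ Y := (abs_nonneg _).trans h1
  calc _ ≤ |μ| * Y * 3 := by
        gcongr
        exact norm_gnSpin_le h hα0 hα1 a b
    _ = _ := by ring

/-- The exponent is at least -1/2 whatever μ and θ are, so the bound is uniform in both. -/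
lemma abs_weight_le_two {Ω θ μ α : ℝ} {w : ℝ → ℝ} (hΩ0 : 0 < Ω) (hΩ1 : Ω < 1) (hθ : 0 < θ)
    (hw : w = gnWeight Ω θ μ ∨ w = fun _ => 1) (hα0 : 0 < α) (hα1 : α ≤ 1 / 10) : |w α| ≤ 2 := by
  rcases hw with rfl | rfl
  · have hC := gnC_pos hΩ0 hΩ1
    have hs := half_le_sqrt_one_sub hα1
    have hpow : (1 - α) ^ (μ ^ 2 * θ / (8 * Ω) - 1 / 2) ≤ 2 := by
      calc (1 - α) ^ (μ ^ 2 * θ / (8 * Ω) - 1 / 2) ≤ (1 - α) ^ (-(1 / 2) : ℝ) := by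
            refine Real.rpow_le_rpow_of_exponent_ge (by linarith) (by linarith) ?_
            have : 0 ≤ μ ^ 2 * θ / (8 * Ω) := by positivity
            linarith
        _ = (Real.sqrt (1 - α))⁻¹ := by
            rw [Real.rpow_neg (by linarith), Real.sqrt_eq_rpow]
        _ ≤ 2 := by
            rw [inv_le_comm₀ (by linarith) (by norm_num)]
            linarith
    have hpow0 : 0 ≤ (1 - α) ^ (μ ^ 2 * θ / (8 * Ω) - 1 / 2) := Real.rpow_nonneg (by linarith) _
    rw [gnWeight, abs_of_nonneg (by positivity)]
    refine (div_le_self hpow0 ?_).trans hpow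
    have : 0 < gnC Ω * α := by positivity
    linarith
  · norm_num

lemma norm_gnSlice_le {Ω θ M B : ℝ} (hΩ0 : 0 < Ω) (hΩ1 : Ω < 1) (hM : 1 < M)
    {i : ℕ} {w : ℝ → ℝ} {G : ℝ → Matrix (Fin 2) (Fin 2) ℂ} {a b : Fin 2} (hB0 : 0 ≤ B)
    (hw : ∀ α, M ^ (-(i : ℝ)) < α → α ≤ M * M ^ (-(i : ℝ)) → |w α| ≤ 2)
    (hG : ∀ α, M ^ (-(i : ℝ)) < α → α ≤ M * M ^ (-(i : ℝ)) → ‖G α a b‖ ≤ B) :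
    ‖gnSlice Ω θ M i w G a b‖ ≤ 4 / (θ ^ 2 * Real.pi) * B * (M * M ^ (-(i : ℝ))) := by
  have hε : 0 < M ^ (-(i : ℝ)) := Real.rpow_pos_of_pos (by linarith) _
  have hend : M ^ (-(i : ℝ) + 1) = M * M ^ (-(i : ℝ)) := by
    rw [Real.rpow_add (by linarith), Real.rpow_one, mul_comm]
  have hpi : 1 ≤ Real.pi := by linarith [Real.pi_gt_three]
  rw [gnSlice, Matrix.of_apply, norm_mul, Complex.norm_real, norm_neg,
    Real.norm_of_nonneg (by positivity), hend]
  set ε := M ^ (-(i : ℝ))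
  have hle : ε ≤ M * ε := by nlinarith
  have hint : ‖∫ α in ε..(M * ε), (w α : ℂ) * G α a b‖ ≤ 2 * B * |M * ε - ε| := by
    refine intervalIntegral.norm_integral_le_of_norm_le_const fun α hα => ?_
    rw [Set.uIoc_of_le hle] at hα
    rw [norm_mul, Complex.norm_real]
    exact mul_le_mul (hw α hα.1 hα.2) (hG α hα.1 hα.2) (norm_nonneg _) zero_le_two
  rw [abs_of_nonneg (by linarith)] at hint
  -- At θ = 0 both sides are 0 by the convention for division by zero.
  rcases eq_or_ne θ 0 with rfl | hθ
  · simp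
  calc _ ≤ 2 * Ω / (θ ^ 2 * Real.pi ^ 2) * (2 * B * (M * ε - ε)) := by gcongr
    _ ≤ 2 * 1 / (θ ^ 2 * Real.pi) * (2 * B * (M * ε)) := by
      have : Real.pi ≤ Real.pi ^ 2 := by nlinarith
      have hd : 0 ≤ M * ε - ε := by linarith
      have hd' : M * ε - ε ≤ M * ε := by linarith
      gcongr
    _ = _ := by ring

theorem theorem1 :
    ∃ Ω₀ : ℝ, 0 < Ω₀ ∧ Ω₀ < 1 ∧
      ∀ Ω : ℝ, Ω₀ < Ω → Ω < 1 → ∀ M : ℝ, 1 < M →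
        ∃ K c : ℝ, ∃ i₀ : ℕ, 0 < K ∧ 0 < c ∧
          ∀ (θ μ : ℝ) (γ0 γ1 : Matrix (Fin 2) (Fin 2) ℂ) (w : ℝ → ℝ),
            0 < θ → IsGammaPair γ0 γ1 →
            (w = gnWeight Ω θ μ ∨ w = fun _ => 1) →
            ∀ i : ℕ, i₀ ≤ i → ∀ (m h p k : ℕ) (a b : Fin 2),
              ‖gnSliceComm Ω θ M i w γ0 γ1 m (m + h) k (m + p) a b‖ ≤
                  K * θ ^ (-(3 / 2) : ℝ) * M ^ (-(i : ℝ) / 2) * gnBound Ω M c i k h p ∧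
              ‖gnSliceMass Ω θ μ M i w γ0 γ1 m (m + h) k (m + p) a b‖ ≤
                  K * (|μ| / θ ^ 2) * M ^ (-(i : ℝ)) * gnBound Ω M c i k h p := by
  -- The threshold 1/2 serves only to give Ω > 0.
  refine ⟨1 / 2, by norm_num, by norm_num, fun Ω hΩ hΩ1 M hM => ?_⟩
  have hΩ0 : 0 < Ω := by linarith
  have hM0 : 0 < M := by linarith
  have hC := gnC_pos hΩ0 hΩ1
  -- This i₀ makes (1+2C)α ≤ 1/10 on every slice i ≥ i₀, whose upper end is M·M^(-i).
  obtain ⟨i₀, hi₀⟩ := pow_unbounded_of_one_lt (10 * (1 + 2 * gnC Ω) * M) hM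
  obtain ⟨c, hc⟩ : ∃ c, c = 1 / (768 * (1 + 2 * gnC Ω)) := ⟨_, rfl⟩
  have hc0 : 0 < c := by rw [hc]; positivity
  set b₀ := min (1 / 2) (gnC Ω / 4) with hb₀
  have hb0 : 0 < b₀ := lt_min (by norm_num) (by positivity)
  have hb : b₀ ≤ 1 / 2 := min_le_left _ _
  have hbC : b₀ ≤ gnC Ω / 4 := min_le_right _ _
  set K₁ := 64 * 2048 ^ 2 / b₀ * Real.sqrt (1 + gnC Ω) with hK₁
  set K₂ := (16 * 2048 ^ 2 / b₀ : ℝ) with hK₂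
  have hK₁0 : 0 < K₁ := by positivity
  have hK₂0 : 0 < K₂ := by positivity
  -- 1152 = 4·288 and 12 = 4·3 join the slice constant to those of the two integrands; one K serves
  -- both parts.
  refine ⟨1152 * K₁ * M + 12 * K₂ * M, c / M, i₀, by positivity, by positivity, ?_⟩
  intro θ μ γ0 γ1 w hθ hγ hw i hi m h p k a b
  have hpi : 1 ≤ Real.pi := by linarith [Real.pi_gt_three]
  have hεeq : M ^ (-(i : ℝ)) = (M ^ i)⁻¹ := by rw [Real.rpow_neg hM0.le, Real.rpow_natCast]
  have hsqrt : M ^ (-(i : ℝ) / 2) = Real.sqrt (M ^ (-(i : ℝ))) := by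
    rw [Real.sqrt_eq_rpow, ← Real.rpow_mul hM0.le]
    congr 1
    ring
  have hθpow : θ ^ (-(3 / 2) : ℝ) = Real.sqrt θ / θ ^ 2 := by
    rw [Real.sqrt_eq_rpow, ← Real.rpow_natCast θ 2, ← Real.rpow_sub hθ]
    norm_num
  have hbound : gnBound Ω M (c / M) i k h p =
      decayProfile (gnC Ω) (M ^ (-(i : ℝ))) (c / M) k h p := rfl
  have hMi : 10 * (1 + 2 * gnC Ω) * M ≤ M ^ i :=
    hi₀.le.trans (pow_le_pow_right₀ hM.le hi)
  have hε : 0 < M ^ (-(i : ℝ)) := Real.rpow_pos_of_pos hM0 _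
  have hsmall : (1 + 2 * gnC Ω) * (M * M ^ (-(i : ℝ))) ≤ 1 / 10 := by
    rw [hεeq, ← mul_assoc, ← div_eq_mul_inv, div_le_iff₀ (by positivity)]
    linarith
  set ε := M ^ (-(i : ℝ)) with hεdef
  rw [hbound, hsqrt, hθpow]
  set D := decayProfile (gnC Ω) ε (c / M) k h p with hD
  have hD0 : 0 ≤ D := by
    rw [hD]
    unfold decayProfile
    positivity
  have hαsm : ∀ α, α ≤ M * ε → (1 + 2 * gnC Ω) * α ≤ 1 / 10 := fun α hα =>
    (mul_le_mul_of_nonneg_left hα (by linarith)).trans hsmall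
  have hα10 : ∀ α, ε < α → α ≤ M * ε → α ≤ 1 / 10 := fun α hα1 hα2 => by
    have := hαsm α hα2
    have h0 : 0 ≤ gnC Ω * α := mul_nonneg hC.le (by linarith)
    linarith
  have hwle : ∀ α, ε < α → α ≤ M * ε → |w α| ≤ 2 := fun α hα1 hα2 =>
    abs_weight_le_two hΩ0 hΩ1 hθ hw (by linarith) (hα10 α hα1 hα2)
  have hprof : ∀ α, ε < α → α ≤ M * ε → decayProfile (gnC Ω) α c k h p ≤ D := fun α hα1 hα2 =>
    decayProfile_le hε hα1.le hM.le hα2 hc0.le k h p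
  have hsε : Real.sqrt ε * Real.sqrt ε = ε := Real.mul_self_sqrt hε.le
  have hsε0 : 0 < Real.sqrt ε := Real.sqrt_pos.2 hε
  constructor
  · have hG : ∀ α, ε < α → α ≤ M * ε → ‖gnAlphaComm Ω θ α γ0 γ1 m (m + h) k (m + p) a b‖ ≤
        288 * Real.pi * Real.sqrt θ * (K₁ / Real.sqrt ε * D) := by
      intro α hα1 hα2
      have hα0 : 0 < α := hε.trans hα1
      obtain ⟨l1, l2⟩ := abs_lowerComm_le_decayProfile hΩ0 hΩ1 hα0 (hαsm α hα2) hb0 hb hbC hc m h p k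
      have hstep : K₁ * Real.sqrt α * decayProfile (gnC Ω) α c k h p ≤ K₁ * Real.sqrt α * D := by
        have := hprof α hα1 hα2
        gcongr
      refine (norm_gnAlphaComm_le hΩ0 hΩ1 hα0 (hα10 α hα1 hα2) hθ hγ (l1.trans hstep)
        (l2.trans hstep) a b).trans ?_
      have e1 : K₁ * Real.sqrt α * D / α = K₁ / Real.sqrt α * D := by
        have : Real.sqrt α * Real.sqrt α = α := Real.mul_self_sqrt hα0.le
        have h0 : 0 < Real.sqrt α := Real.sqrt_pos.2 hα0
        rw [div_mul_eq_mul_div, div_eq_div_iff hα0.ne' h0.ne']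
        linear_combination K₁ * D * this
      rw [e1]
      gcongr
    refine (norm_gnSlice_le hΩ0 hΩ1 hM (by positivity) hwle hG).trans ?_
    have hE : 4 / (θ ^ 2 * Real.pi) * (288 * Real.pi * Real.sqrt θ * (K₁ / Real.sqrt ε * D)) *
        (M * ε) = 1152 * K₁ * M * (Real.sqrt θ / θ ^ 2) * Real.sqrt ε * D := by
      rw [show M * ε = M * (Real.sqrt ε * Real.sqrt ε) by rw [hsε]]
      field_simp
      ring
    rw [hE]
    gcongr
    have : 0 ≤ 12 * K₂ * M := by positivity
    linarith
  · have hG : ∀ α, ε < α → α ≤ M * ε → ‖gnAlphaMass Ω μ α γ0 γ1 m (m + h) k (m + p) a b‖ ≤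
        3 * |μ| * (K₂ * D) := by
      intro α hα1 hα2
      have hα0 : 0 < α := hε.trans hα1
      refine norm_gnAlphaMass_le hα0 (hα10 α hα1 hα2) hγ
        ((gnGamma_le_decayProfile hΩ0 hΩ1 hα0 (hαsm α hα2) hb0 hb hbC hc m h p k).trans ?_) a b
      have := hprof α hα1 hα2
      gcongr
    refine (norm_gnSlice_le hΩ0 hΩ1 hM (by positivity) hwle hG).trans ?_
    calc _ = 12 * K₂ * M * (|μ| / θ ^ 2) * ε * D / Real.pi := by
          field_simp
          ring
      _ ≤ 12 * K₂ * M * (|μ| / θ ^ 2) * ε * D := div_le_self (by positivity) hpi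
      _ ≤ _ := by
        gcongr
        have : 0 ≤ 1152 * K₁ * M := by positivity
        linarith
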